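/- Let $k\in\mathbb N$ and let $\mu$ be a probability distribution on the set of Boolean functions $\varphi:\{-1,+1\}^k\to\{0,1\}$. For $n\in\mathbb N$ and $\alpha\ge 0$, the random formula $F(\alpha,n,\mu)$ on variables $x_1,\dots,x_n\in\{-1,+1\}$ consists of $m=\lfloor\alpha n\rfloor$ independent random clauses; the $a$-th clause is $\varphi_a(x_{i_1(a)},\dots,x_{i_k(a)})$, where $i_1(a),\dots,i_k(a)$ are independent and uniform in $\{1,\dots,n\}$ and $\varphi_a$ is drawn from $\mu$ independently of them. Let $Z(F)$ be the number of $x\in\{-1,+1\}^n$ that satisfy $F$, i.e. $\varphi_a(x_{i_1(a)},\dots,x_{i_k(a)})=1$ for all $a\le m$. Put $$P_n(\alpha,\phi,\mu)=\mathbb P\{Z(F(\alpha,n,\mu))<2^{n\phi}\},$$ so that $P_n(\alpha,0,\mu)=\mathbb P\{Z(F(\alpha,n,\mu))=0\}$, and $$\alpha^*(\mu)=\sup\Big\{\alpha\ge 0:\ P_n(\alpha,0,\mu)=O\big(1/(\log n)^{1+\varepsilon}\big)\text{ as }n\to\infty\text{ for some }\varepsilon>0\Big\}\in[0,\infty].$$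 For $l\ge 1$ and a probability measure $\nu$ on $\{-1,+1\}^l$ let $$\Gamma_l(\nu)=\mathbb E\prod_{r=1}^l\big(1-\varphi(Z_1^{(r)},\dots,Z_k^{(r)})\big),$$ where $\varphi\sim\mu$ and, independently of $\varphi$, the vectors $Z_i=(Z_i^{(1)},\dots,Z_i^{(l)})$, $i=1,\dots,k$, are i.i.d. with law $\nu$. Hypothesis H2 on $\mu$: for every $l\ge 1$, $\Gamma_l$ is a convex function on the set of probability measures on $\{-1,+1\}^l$. **Theorem.** Assume that $\mu$ satisfies H2. Then there is a real-valued function $\phi_s$ such that for every $\alpha$ with $0\le\alpha<\alpha^*(\mu)$, the event $\{Z(F(\alpha,n,\mu))\ge1\}$ has positive probability for all sufficiently large $n$, and $$\psi_n(\alpha):=\frac1n\,\mathbb E\big[\log_2 Z(F(\alpha,n,\mu))\,\big|\,Z(F(\alpha,n,\mu))\ge1\big]\ \longrightarrow\ \phi_s(\alpha)\qquad(n\to\infty).$$ -/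

import Mathlib

open Filter Topology MeasureTheory ProbabilityTheory
open scoped NNReal ENNReal

namespace RandomCSP

noncomputable section

/-- A spin, that is, an element of `{-1, +1}` (the units of `ℤ`). -/
abbrev Spin : Type := ℤˣ

/-- A clause type of arity `k`: a Boolean function `{-1, +1}^k → {0, 1}`. -/
abbrev ClauseType (k : ℕ) : Type := (Fin k → Spin) → Bool

/-- A clause on `n` variables: `k` variable indices (repetitions allowed) and a clause type. -/
abbrev Clause (k n : ℕ) : Type := (Fin k → Fin n) × ClauseType k

/-- A formula with `m` clauses on `n` variables. -/
abbrev Formula (k n m : ℕ) : Type := Fin m → Clause k n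

variable {k n m : ℕ}

/-- The assignment `x` satisfies every clause `φ_a(x_{i_1(a)}, …, x_{i_k(a)})` of `F`. -/
def Satisfies (x : Fin n → Spin) (F : Formula k n m) : Prop :=
  ∀ a : Fin m, (F a).2 (fun j => x ((F a).1 j)) = true

/-- The number `Z(F)` of satisfying assignments of `F`. -/
def Z (F : Formula k n m) : ℕ :=
  Nat.card {x : Fin n → Spin // Satisfies x F}

/-- The law of one random clause: `k` independent uniform indices in `[n]`, and, independently,
a clause type with distribution `μ`. -/
def clauseLaw (μ : PMF (ClauseType k)) (n : ℕ) : Measure (Clause k n) :=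
  (Measure.pi fun _ : Fin k => uniformOn (Set.univ : Set (Fin n))).prod μ.toMeasure

/-- The number `⌊α n⌋` of clauses. -/
def numClauses (α : ℝ≥0) (n : ℕ) : ℕ := ⌊(α : ℝ) * n⌋₊

/-- The law of the random formula `F(α, n, μ)`: `⌊α n⌋` independent random clauses. -/
def formulaLaw (μ : PMF (ClauseType k)) (α : ℝ≥0) (n : ℕ) :
    Measure (Formula k n (numClauses α n)) :=
  Measure.pi fun _ => clauseLaw μ n

/-- `P_n(α, φ, μ)`, the probability that `F(α, n, μ)` has fewer than `2^{nφ}` satisfying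
assignments. -/
def probFewer (μ : PMF (ClauseType k)) (n : ℕ) (α : ℝ≥0) (φ : ℝ) : ℝ :=
  (formulaLaw μ α n).real {F | (Z F : ℝ) < (2 : ℝ) ^ ((n : ℝ) * φ)}

/-- `α*(μ)`, the supremum (possibly infinite) of the densities `α ≥ 0` such that the probability
`P_n(α, 0, μ)` of being unsatisfiable is `O(1 / (log n)^{1+ε})` for some `ε > 0`. -/
def alphaStar (μ : PMF (ClauseType k)) : ℝ≥0∞ :=
  sSup ((fun α : ℝ≥0 => (α : ℝ≥0∞)) '' {α : ℝ≥0 | ∃ ε : ℝ, 0 < ε ∧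
    (fun n : ℕ => probFewer μ n α 0) =O[atTop] (fun n : ℕ => 1 / Real.log n ^ (1 + ε))})

/-- The functional `Γ_l`. A probability measure on the finite set `{-1, +1}^l` is given by its
mass function `ν`; the outer sum is the expectation over the clause type `φ`, and the inner sum is
the expectation over `Z_1, …, Z_k`, independent with law `ν`, where `z i r` is `Z_i^{(r)}`. -/
def Gamma (μ : PMF (ClauseType k)) (l : ℕ) (ν : (Fin l → Spin) → ℝ) : ℝ :=
  ∑ φ : ClauseType k, (μ φ).toReal *
    ∑ z : Fin k → Fin l → Spin,
      (∏ i : Fin k, ν (z i)) * ∏ r : Fin l, (1 - if φ (fun i => z i r) then (1 : ℝ) else 0)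

/-- Hypothesis H2: `Γ_l` is convex on the probability measures on `{-1, +1}^l`, for all `l ≥ 1`. -/
def H2 (μ : PMF (ClauseType k)) : Prop :=
  ∀ l : ℕ, 1 ≤ l → ConvexOn ℝ (stdSimplex ℝ (Fin l → Spin)) (Gamma μ l)

/-- The event `Z(F) ≥ 1`. -/
def satEvent (k n m : ℕ) : Set (Formula k n m) := {F | 1 ≤ Z F}

/-- `ψ_n(α) = (1/n) E[log₂ Z(F(α, n, μ)) | Z(F(α, n, μ)) ≥ 1]`, the expectation under the
conditional law of the formula. -/
def psi (μ : PMF (ClauseType k)) (n : ℕ) (α : ℝ≥0) : ℝ :=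
  (1 / (n : ℝ)) *
    ∫ F, Real.logb 2 (Z F) ∂((formulaLaw μ α n)[|satEvent k n (numClauses α n)])

end

end RandomCSP

/-! The proof is the interpolation method, with log₂(Z+1) in place of log₂ Z so that no formula has
to be excluded. Imposing a random clause is an averaging operator `clauseOp μ ρ` on functions of the
surviving set of assignments, ρ being the law of an index; these operators all commute. If v is the
fraction of S (with one phantom element added) violating a clause, imposing it lowers log(|S|+1) by
-log(1-v) = Σ v^l/l. The mean of v^l is an average of Γ_l over l-tuples of replicas from S, so H2
makes the mean loss convex in ρ (`clauseOp_logCount_concave`). Commutation carries this through m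
clauses.

A uniform index on n₁+n₂ variables is a mixture of uniform indices on two blocks. Hence 𝔼 log₂(Z+1)
is nearly superadditive in n; the defect, relative to n₁+n₂, is of the order of ℙ(Z=0) on a block
plus 1/(n₁+n₂). With a Poisson number of clauses the blocks are independent (`poissonLog_split`).
Below α* the defect at scale 2^s is summable in s, since 1/(log n)^{1+ε} becomes s^{-(1+ε)}, and a
de Bruijn–Erdős argument gives a limit L.

To return to ⌊αn⌋ clauses, the lower bound L-η is shown to persist slightly above α, because the
superadditivity estimate is uniform in the density (`eventually_meanLog_ge`). A Poisson count falls
below its mean with probability bounded below, so a larger value at ⌊αn⌋ clauses would push the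
Poisson average above L (`tendsto_meanLog`). Conditioning on Z ≥ 1 is harmless because ℙ(Z=0) → 0.
-/

namespace RandomCSP

/-! ### Averaging operators of random clauses. -/

/-- The assignments that satisfy a given clause. -/
def satSet {k n : ℕ} (c : Clause k n) : Finset (Fin n → Spin) :=
  Finset.univ.filter fun x => c.2 (fun j => x (c.1 j)) = true

/-- The probability of a clause whose indices are independent with mass function `ρ` and whose
type has law `μ`. -/
noncomputable def clauseWeight {k n : ℕ} (μ : PMF (ClauseType k)) (ρ : Fin n → ℝ)
    (c : Clause k n) : ℝ :=
  (∏ j, ρ (c.1 j)) * (μ c.2).toReal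

/-- The averaging operator `(T h)(S) = 𝔼 h(S ∩ {x : x satisfies c})`, where the random clause `c`
has independent indices with mass function `ρ` and a type with law `μ`. -/
noncomputable def clauseOp {k n : ℕ} (μ : PMF (ClauseType k)) (ρ : Fin n → ℝ) :
    Module.End ℝ (Finset (Fin n → Spin) → ℝ) where
  toFun h S := ∑ c : Clause k n, clauseWeight μ ρ c * h (S ∩ satSet c)
  map_add' h h' := by
    ext S
    simp [mul_add, Finset.sum_add_distrib]
  map_smul' a h := by
    ext S
    simp only [Pi.smul_apply, smul_eq_mul, RingHom.id_apply, Finset.mul_sum]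
    exact Finset.sum_congr rfl fun c _ => by ring

/-- The logarithm of the number of elements plus one. -/
noncomputable def logCount {n : ℕ} (S : Finset (Fin n → Spin)) : ℝ := Real.logb 2 (S.card + 1)

section

variable {k n : ℕ} {μ : PMF (ClauseType k)} {ρ ρ' : Fin n → ℝ}

lemma clauseOp_apply (h : Finset (Fin n → Spin) → ℝ) (S : Finset (Fin n → Spin)) :
    clauseOp μ ρ h S = ∑ c : Clause k n, clauseWeight μ ρ c * h (S ∩ satSet c) := rfl

lemma sum_toReal_pmf {α : Type*} [Fintype α] (p : PMF α) : ∑ a, (p a).toReal = 1 := by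
  rw [← ENNReal.toReal_sum fun a _ => p.apply_ne_top a, ← tsum_fintype (L := .unconditional _),
    p.tsum_coe, ENNReal.toReal_one]

lemma sum_prod_eq_one (h1 : ∑ v, ρ v = 1) : ∑ i : Fin k → Fin n, ∏ j, ρ (i j) = 1 := by
  rw [← Fintype.sum_pow, h1, one_pow]

lemma sum_clauseWeight (h1 : ∑ v, ρ v = 1) : ∑ c : Clause k n, clauseWeight μ ρ c = 1 := by
  simp only [clauseWeight, Fintype.sum_prod_type, ← Finset.mul_sum, sum_toReal_pmf, mul_one]
  exact sum_prod_eq_one h1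

lemma clauseWeight_nonneg (h0 : 0 ≤ ρ) (c : Clause k n) : 0 ≤ clauseWeight μ ρ c :=
  mul_nonneg (Finset.prod_nonneg fun _ _ => h0 _) ENNReal.toReal_nonneg

lemma clauseOp_mono (h0 : 0 ≤ ρ) : Monotone (clauseOp μ ρ) := fun _ _ hh _ =>
  Finset.sum_le_sum fun c _ => mul_le_mul_of_nonneg_left (hh _) (clauseWeight_nonneg h0 c)

lemma clauseOp_pow_mono (h0 : 0 ≤ ρ) (m : ℕ) : Monotone ((clauseOp μ ρ) ^ m) := by
  intro h h' hh
  rw [Module.End.pow_apply, Module.End.pow_apply]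
  exact (clauseOp_mono h0).iterate m hh

/-- Intersection is commutative, so the order in which clauses are imposed is irrelevant. This lets
one clause at a time be exchanged in the interpolation, and later permits the binomial theorem. -/
lemma clauseOp_commute : Commute (clauseOp μ ρ) (clauseOp μ ρ') := by
  refine LinearMap.ext fun h => funext fun S => ?_
  simp only [Module.End.mul_apply, clauseOp_apply, Finset.mul_sum]
  rw [Finset.sum_comm]
  refine Finset.sum_congr rfl fun c _ => Finset.sum_congr rfl fun c' _ => ?_
  rw [Finset.inter_right_comm]
  ring

lemma clauseOp_const (h1 : ∑ v, ρ v = 1) (a : ℝ) :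
    clauseOp μ ρ (fun _ => a) = fun _ => a := by
  ext S
  rw [clauseOp_apply, ← Finset.sum_mul, sum_clauseWeight h1, one_mul]

lemma clauseOp_pow_const (h1 : ∑ v, ρ v = 1) (a : ℝ) (m : ℕ) :
    ((clauseOp μ ρ) ^ m) (fun _ => a) = fun _ => a := by
  rw [Module.End.pow_apply]
  exact Function.iterate_fixed (clauseOp_const h1 a) m

lemma clauseOp_le_of_monotone (h0 : 0 ≤ ρ) (h1 : ∑ v, ρ v = 1)
    {h : Finset (Fin n → Spin) → ℝ} (hh : Monotone h) : clauseOp μ ρ h ≤ h := by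
  intro S
  calc clauseOp μ ρ h S ≤ ∑ c : Clause k n, clauseWeight μ ρ c * h S :=
        Finset.sum_le_sum fun c _ => mul_le_mul_of_nonneg_left (hh Finset.inter_subset_left)
          (clauseWeight_nonneg h0 c)
    _ = h S := by rw [← Finset.sum_mul, sum_clauseWeight h1, one_mul]

lemma clauseOp_pow_antitone (h0 : 0 ≤ ρ) (h1 : ∑ v, ρ v = 1)
    {h : Finset (Fin n → Spin) → ℝ} (hh : Monotone h) :
    Antitone fun m : ℕ => ((clauseOp μ ρ) ^ m) h := by
  refine antitone_nat_of_succ_le fun m => ?_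
  rw [pow_succ, Module.End.mul_apply]
  exact clauseOp_pow_mono h0 m (clauseOp_le_of_monotone h0 h1 hh)

/-! ### Replicas and the interpolation inequality. -/

/-- Change of variables for products of mass functions. -/
lemma sum_prod_map {V W : Type*} [Fintype V] [Fintype W] [DecidableEq V] [DecidableEq W]
    (π : V → W) (ρ : V → ℝ) (H : (Fin k → W) → ℝ) :
    ∑ z : Fin k → W, (∏ j, ∑ v, if π v = z j then ρ v else 0) * H z
      = ∑ i : Fin k → V, (∏ j, ρ (i j)) * H (π ∘ i) := by
  simp only [Finset.prod_univ_sum, Fintype.piFinset_univ, Finset.sum_mul]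
  rw [Finset.sum_comm]
  refine Finset.sum_congr rfl fun i _ => ?_
  rw [Finset.sum_eq_single (π ∘ i)]
  · simp
  · intro z _ hz
    obtain ⟨j, hj⟩ : ∃ j, π (i j) ≠ z j := by
      by_contra! h
      exact hz (funext fun j => (h j).symm)
    rw [Finset.prod_eq_zero (Finset.mem_univ j) (by simp [hj]), zero_mul]
  · simp

/-- The empirical law of `l` replicas `x 0, …, x (l - 1)` at a random index with mass function
`ρ`. -/
noncomputable def replicaLaw {l : ℕ} (x : Fin l → Fin n → Spin) (ρ : Fin n → ℝ) :
    (Fin l → Spin) → ℝ :=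
  fun s => ∑ v, if (fun r => x r v) = s then ρ v else 0

lemma replicaLaw_mem {l : ℕ} (x : Fin l → Fin n → Spin) (hρ : ρ ∈ stdSimplex ℝ (Fin n)) :
    replicaLaw x ρ ∈ stdSimplex ℝ (Fin l → Spin) := by
  refine ⟨fun s => Finset.sum_nonneg fun v _ => ?_, ?_⟩
  · split_ifs
    exacts [hρ.1 v, le_rfl]
  · simp only [replicaLaw]
    rw [Finset.sum_comm]
    simpa using hρ.2

lemma replicaLaw_combo {l : ℕ} (x : Fin l → Fin n → Spin) (p q : ℝ) :
    replicaLaw x (p • ρ + q • ρ') = p • replicaLaw x ρ + q • replicaLaw x ρ' := by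
  ext s
  simp only [replicaLaw, Pi.add_apply, Pi.smul_apply, smul_eq_mul, Finset.mul_sum,
    ← Finset.sum_add_distrib]
  refine Finset.sum_congr rfl fun v _ => ?_
  split_ifs <;> ring

/-- The columns of the replicas at k independent indices are i.i.d. with the replica law, so Γ_l is
the chance that a random clause is violated by all l replicas at once. -/
lemma Gamma_replicaLaw {l : ℕ} (x : Fin l → Fin n → Spin) :
    Gamma μ l (replicaLaw x ρ)
      = ∑ c : Clause k n, clauseWeight μ ρ c * ∏ r, if x r ∈ satSet c then (0 : ℝ) else 1 := by
  simp only [Gamma, replicaLaw, clauseWeight, Fintype.sum_prod_type_right]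
  refine Finset.sum_congr rfl fun φ _ => ?_
  rw [sum_prod_map (fun v r => x r v) ρ, Finset.mul_sum]
  refine Finset.sum_congr rfl fun i _ => ?_
  have : ∀ r, (if x r ∈ satSet ((i, φ) : Clause k n) then (0 : ℝ) else 1)
      = 1 - if φ (fun j => ((fun v r => x r v) ∘ i) j r) then (1 : ℝ) else 0 := by
    intro r
    by_cases h : φ (fun j => x r (i j)) <;> simp [satSet, h]
  simp only [this]
  ring

/-- The fraction of the elements of `S`, one additional element included, that violate a clause. -/
noncomputable def violFrac (S : Finset (Fin n → Spin)) (c : Clause k n) : ℝ :=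
  (∑ x ∈ S, if x ∈ satSet c then (0 : ℝ) else 1) / (S.card + 1)

/-- The additional element never violates a clause, so a clause acts multiplicatively on the
cardinality plus one. -/
lemma card_inter_satSet (S : Finset (Fin n → Spin)) (c : Clause k n) :
    ((S ∩ satSet c).card : ℝ) + 1 = (S.card + 1) * (1 - violFrac S c) := by
  have hS : (S.card : ℝ) + 1 ≠ 0 := by positivity
  have h : ((S ∩ satSet c).card : ℝ) = ∑ x ∈ S, if x ∈ satSet c then (1 : ℝ) else 0 := by
    rw [Finset.sum_boole, Finset.filter_mem_eq_inter]
  have h' : (S.card : ℝ) = (∑ x ∈ S, if x ∈ satSet c then (1 : ℝ) else 0)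
      + ∑ x ∈ S, if x ∈ satSet c then (0 : ℝ) else 1 := by
    rw [← Finset.sum_add_distrib, Finset.card_eq_sum_ones]
    push_cast
    exact Finset.sum_congr rfl fun x _ => by split_ifs <;> simp
  rw [violFrac, mul_sub, mul_div_cancel₀ _ hS, mul_one, h]
  linarith

lemma violFrac_nonneg (S : Finset (Fin n → Spin)) (c : Clause k n) : 0 ≤ violFrac S c := by
  refine div_nonneg (Finset.sum_nonneg fun x _ => ?_) (by positivity)
  split_ifs <;> norm_num

lemma violFrac_lt_one (S : Finset (Fin n → Spin)) (c : Clause k n) : violFrac S c < 1 := by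
  have h := card_inter_satSet S c
  have : 0 < ((S.card : ℝ) + 1) * (1 - violFrac S c) := by rw [← h]; positivity
  have := pos_of_mul_pos_right this (by positivity)
  linarith

/-- The l-th power of a sum over S is a sum over l-tuples of replicas from S; this is how Γ_l
enters. -/
lemma sum_clauseWeight_violFrac_pow (S : Finset (Fin n → Spin)) (l : ℕ) :
    ∑ c : Clause k n, clauseWeight μ ρ c * violFrac S c ^ l
      = (∑ x ∈ Fintype.piFinset fun _ : Fin l => S, Gamma μ l (replicaLaw x ρ))
        / ((S.card : ℝ) + 1) ^ l := by
  simp only [violFrac, div_pow, Finset.sum_pow', Gamma_replicaLaw]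
  rw [Finset.sum_comm, Finset.sum_div]
  refine Finset.sum_congr rfl fun c _ => ?_
  rw [← Finset.mul_sum, mul_div_assoc]

lemma hasSum_logCount (S : Finset (Fin n → Spin)) (c : Clause k n) :
    HasSum (fun l : ℕ => violFrac S c ^ (l + 1) / (l + 1) / Real.log 2)
      (logCount S - logCount (S ∩ satSet c)) := by
  have h0 := violFrac_nonneg S c
  have h1 := violFrac_lt_one S c
  have := (Real.hasSum_pow_div_log_of_abs_lt_one (x := violFrac S c)
    (by rw [abs_of_nonneg h0]; exact h1)).div_const (Real.log 2)
  have e : logCount S - logCount (S ∩ satSet c) = -Real.log (1 - violFrac S c) / Real.log 2 := by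
    simp only [logCount, card_inter_satSet, Real.logb]
    rw [Real.log_mul (by positivity) (by linarith)]
    ring
  rwa [e]

/-- The law ρ enters the mean loss only through the functionals Γ, with nonnegative coefficients, so
convexity in ρ can be checked term by term. -/
lemma hasSum_clauseOp_logCount (h1 : ∑ v, ρ v = 1) (S : Finset (Fin n → Spin)) :
    HasSum (fun l : ℕ =>
      (∑ x ∈ Fintype.piFinset fun _ : Fin (l + 1) => S, Gamma μ (l + 1) (replicaLaw x ρ))
        * (1 / ((S.card : ℝ) + 1) ^ (l + 1) / (l + 1) / Real.log 2))
      (logCount S - clauseOp μ ρ logCount S) := by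
  have h := hasSum_sum (s := (Finset.univ : Finset (Clause k n)))
    fun c _ => (hasSum_logCount S c).mul_left (clauseWeight μ ρ c)
  have e : logCount S - clauseOp μ ρ logCount S
      = ∑ c : Clause k n, clauseWeight μ ρ c * (logCount S - logCount (S ∩ satSet c)) := by
    simp only [mul_sub, Finset.sum_sub_distrib, ← Finset.sum_mul, sum_clauseWeight h1, one_mul]
    rfl
  rw [e]
  refine (congrArg (HasSum · _) (funext fun l => ?_)).mpr h
  have := sum_clauseWeight_violFrac_pow (μ := μ) (ρ := ρ) S (l + 1)
  trans (∑ c : Clause k n, clauseWeight μ ρ c * violFrac S c ^ (l + 1)) / ((l : ℝ) + 1) / Real.log 2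
  · rw [this]
    ring
  · rw [Finset.sum_div, Finset.sum_div]
    exact Finset.sum_congr rfl fun c _ => by ring

/-- Under H2, the average effect of a random clause on `logCount` is concave in the law of its
indices. -/
lemma clauseOp_logCount_concave (hμ : H2 μ) (hρ : ρ ∈ stdSimplex ℝ (Fin n))
    (hρ' : ρ' ∈ stdSimplex ℝ (Fin n)) {p q : ℝ} (hp : 0 ≤ p) (hq : 0 ≤ q) (hpq : p + q = 1) :
    (p • clauseOp μ ρ + q • clauseOp μ ρ') logCount ≤ clauseOp μ (p • ρ + q • ρ') logCount := by
  intro S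
  have hmem := (convex_stdSimplex ℝ (Fin n)) hρ hρ' hp hq hpq
  have hs := ((hasSum_clauseOp_logCount (μ := μ) hρ.2 S).mul_left p).add
    ((hasSum_clauseOp_logCount (μ := μ) hρ'.2 S).mul_left q)
  have hle := hasSum_le (fun l => ?_) (hasSum_clauseOp_logCount (μ := μ) hmem.2 S) hs
  · simp only [LinearMap.add_apply, LinearMap.smul_apply, Pi.add_apply, Pi.smul_apply, smul_eq_mul]
    have : logCount S = p * logCount S + q * logCount S := by rw [← add_mul, hpq, one_mul]
    linarith
  · rw [← mul_assoc, ← mul_assoc, ← add_mul, Finset.mul_sum, Finset.mul_sum,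
      ← Finset.sum_add_distrib]
    have : (0 : ℝ) ≤ Real.log 2 := Real.log_nonneg (by norm_num)
    refine mul_le_mul_of_nonneg_right (Finset.sum_le_sum fun x _ => ?_) (by positivity)
    rw [replicaLaw_combo]
    exact (hμ (l + 1) (by omega)).2 (replicaLaw_mem x hρ) (replicaLaw_mem x hρ') hp hq hpq

/-- The interpolation inequality. -/
lemma clauseOp_pow_logCount_concave (hμ : H2 μ) (hρ : ρ ∈ stdSimplex ℝ (Fin n))
    (hρ' : ρ' ∈ stdSimplex ℝ (Fin n)) {p q : ℝ} (hp : 0 ≤ p) (hq : 0 ≤ q) (hpq : p + q = 1)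
    (m : ℕ) :
    ((p • clauseOp μ ρ + q • clauseOp μ ρ') ^ m) logCount
      ≤ ((clauseOp μ (p • ρ + q • ρ')) ^ m) logCount := by
  have hmem := (convex_stdSimplex ℝ (Fin n)) hρ hρ' hp hq hpq
  set A := p • clauseOp μ ρ + q • clauseOp μ ρ' with hA
  set B := clauseOp μ (p • ρ + q • ρ') with hB
  have hcomm : Commute A B :=
    (clauseOp_commute.smul_left p).add_left (clauseOp_commute.smul_left q)
  have hmono : Monotone A := by
    intro h h' hh S
    exact add_le_add (mul_le_mul_of_nonneg_left (clauseOp_mono hρ.1 hh S) hp)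
      (mul_le_mul_of_nonneg_left (clauseOp_mono hρ'.1 hh S) hq)
  induction m with
  | zero => simp
  | succ m ih =>
    rw [pow_succ', pow_succ, Module.End.mul_apply, Module.End.mul_apply]
    -- A(A^m f) ≤ A(B^m f) = B^m(A f) ≤ B^m(B f): monotonicity of A, commutation, then the
    -- one-clause inequality.
    refine (hmono ih).trans ?_
    rw [← Module.End.mul_apply, (hcomm.pow_right m).eq, Module.End.mul_apply]
    exact clauseOp_pow_mono hmem.1 m (clauseOp_logCount_concave hμ hρ hρ' hp hq hpq)

end

/-! ### Approximately superadditive sequences. -/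

/-- Approximate superadditivity with a summable relative error, propagated to large scales. -/
lemma block_lower_bound {b e : ℕ → ℝ} {s A : ℕ} {γ : ℝ}
    (hsup : ∀ t, s ≤ t → ∀ n₁ n₂ : ℕ, 2 ^ t ≤ n₁ → 2 ^ t ≤ n₂ →
      b n₁ + b n₂ - (n₁ + n₂) * e t ≤ b (n₁ + n₂))
    (hA : 2 ^ s ≤ A) (hγ : ∀ i, A ≤ i → i ≤ 2 * A → i * γ ≤ b i) (t : ℕ) :
    ∀ i : ℕ, 2 ^ t * A ≤ i → i ≤ 2 ^ (t + 1) * A →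
      i * (γ - ∑ j ∈ Finset.range t, e (j + s)) ≤ b i := by
  induction t with
  | zero => simpa using hγ
  | succ t ih =>
    intro i hi hi'
    have e1 : 2 ^ (t + 1) * A = 2 * (2 ^ t * A) := by ring
    have e2 : 2 ^ (t + 1 + 1) * A = 4 * (2 ^ t * A) := by ring
    rw [e1] at hi
    rw [e2] at hi'
    rw [e1] at ih
    have hpow : 2 ^ (t + s) ≤ 2 ^ t * A := by
      rw [pow_add]
      exact Nat.mul_le_mul_left _ hA
    have hsplit : i / 2 + (i - i / 2) = i := by omega
    -- Both near-halves of i lie in the preceding dyadic window and are at least 2^(t+s), so joining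
    -- them costs i · e(t+s).
    have h1 := ih (i / 2) (by omega) (by omega)
    have h2 := ih (i - i / 2) (by omega) (by omega)
    have h3 := hsup (t + s) (by omega) (i / 2) (i - i / 2) (by omega) (by omega)
    rw [hsplit] at h3
    have hc : ((i / 2 : ℕ) : ℝ) + ((i - i / 2 : ℕ) : ℝ) = i := by exact_mod_cast hsplit
    rw [hc] at h3
    set σ := ∑ j ∈ Finset.range t, e (j + s)
    have hsum : (i : ℝ) * (γ - (σ + e (t + s))) = ((i / 2 : ℕ) : ℝ) * (γ - σ)
        + ((i - i / 2 : ℕ) : ℝ) * (γ - σ) - i * e (t + s) := by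
      rw [← hc]
      ring
    rw [Finset.sum_range_succ, hsum]
    linarith

/-- Blocks of length n are joined one by one to an initial piece n + r, whose value is only bounded
below by 0. That piece is not r alone because both pieces in the hypothesis must have length at
least n. -/
lemma multiple_lower_bound {b : ℕ → ℝ} {ε : ℝ} (hε : 0 ≤ ε) {n K : ℕ} (hb : ∀ i, 0 ≤ b i)
    (hsup : ∀ n₁ n₂ : ℕ, n ≤ n₁ → n ≤ n₂ → b n₁ + b n₂ - (n₁ + n₂) * ε ≤ b (n₁ + n₂))
    (p r : ℕ) (hp : p ≤ K) :
    p * b n - p * (K * n + n + r) * ε ≤ b ((p + 1) * n + r) := by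
  induction p with
  | zero => simpa using hb _
  | succ p ih =>
    have h := hsup n ((p + 1) * n + r) le_rfl (by nlinarith)
    have e1 : n + ((p + 1) * n + r) = (p + 1 + 1) * n + r := by ring
    rw [e1] at h
    have ih := ih (by omega)
    have hpK : (p : ℝ) + 1 ≤ K := by exact_mod_cast hp
    have h2 : ((n : ℝ) + ((p + 1) * n + r : ℕ)) * ε ≤ (K * n + n + r) * ε := by
      refine mul_le_mul_of_nonneg_right ?_ hε
      push_cast
      nlinarith [Nat.cast_nonneg (α := ℝ) n]
    push_cast at *
    linarith

/-- A quantitative form of the de Bruijn–Erdős theorem on approximately superadditive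
sequences. -/
lemma exists_uniform_lower_bound {e : ℕ → ℝ} (he : ∀ s, 0 ≤ e s) (hsum : Summable e) (s₀ : ℕ)
    {η : ℝ} (hη : 0 < η) :
    ∃ n₀ : ℕ, ∃ K : ℕ, ∀ b : ℕ → ℝ, (∀ i, 0 ≤ b i) → (∀ i, 1 ≤ i → b i ≤ 2 * i) →
      (∀ t, s₀ ≤ t → ∀ n₁ n₂ : ℕ, 2 ^ t ≤ n₁ → 2 ^ t ≤ n₂ →
        b n₁ + b n₂ - (n₁ + n₂) * e t ≤ b (n₁ + n₂)) →
      ∀ n, n₀ ≤ n → ∀ N, K * n ≤ N → b n / n - η ≤ b N / N := by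
  -- The loss η is divided into three: the tail of Σ e, the joining of at most 2K blocks, and at
  -- most two blocks of length n left uncounted. The last cost at most 4n ≤ Kn · η/3, which explains
  -- 12/η.
  obtain ⟨K, hK⟩ := exists_nat_ge (12 / η + 1)
  have hK1 : (1 : ℝ) ≤ K := le_trans (by have := div_pos (by norm_num : (0:ℝ) < 12) hη; linarith) hK
  have hKη : 4 / (K : ℝ) ≤ η / 3 := by
    rw [div_le_div_iff₀ (by linarith) (by norm_num)]
    have := (div_le_iff₀ hη).1 (le_trans (by linarith : 12 / η ≤ 12 / η + 1) hK)
    linarith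
  have hev1 : ∀ᶠ s in atTop, ∑' j, e (j + s) < η / 3 :=
    (tendsto_sum_nat_add e).eventually_lt_const (by positivity)
  have hev2 : ∀ᶠ s in atTop, 2 * (K : ℝ) * e s < η / 3 := by
    have := hsum.tendsto_atTop_zero.const_mul (2 * (K : ℝ))
    rw [mul_zero] at this
    exact this.eventually_lt_const (by positivity)
  obtain ⟨s, h1, h2, hs⟩ := (hev1.and (hev2.and (eventually_ge_atTop s₀))).exists
  -- Both witnesses are chosen before b, which later makes the bound uniform in the clause density.
  refine ⟨2 ^ s, K, fun b hb0 hb2 hsup n hn N hN => ?_⟩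
  have hn1 : 1 ≤ n := le_trans Nat.one_le_two_pow hn
  have hKn : 1 ≤ K := by exact_mod_cast hK1
  have hnR : (0 : ℝ) < n := by exact_mod_cast hn1
  have hbn := hb2 n hn1
  have hγ : ∀ i, K * n ≤ i → i ≤ 2 * (K * n) → (i : ℝ) * (b n / n - 2 * η / 3) ≤ b i := by
    intro i hi hi'
    have hdiv : n * (i / n) + i % n = i := Nat.div_add_mod i n
    have hr : i % n < n := Nat.mod_lt _ hn1
    have hq1 : K ≤ i / n := (Nat.le_div_iff_mul_le hn1).2 hi
    have hq2 : i / n ≤ 2 * K := by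
      rw [← mul_assoc] at hi'
      exact Nat.div_le_of_le_mul (by rw [mul_comm]; exact hi')
    obtain ⟨p, hp⟩ : ∃ p, i / n = p + 1 := ⟨i / n - 1, by omega⟩
    have h := multiple_lower_bound (he s) hb0
      (fun n₁ n₂ a1 a2 => hsup s hs n₁ n₂ (hn.trans a1) (hn.trans a2)) p (i % n) (le_refl p)
    have e1 : (p + 1) * n + i % n = i := by rw [← hp, mul_comm]; exact hdiv
    rw [e1] at h
    have e2 : ((p : ℝ) * n + n + (i % n : ℕ)) = i := by
      have : (((p + 1) * n + i % n : ℕ) : ℝ) = i := by rw [e1]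
      push_cast at this
      linarith
    rw [e2] at h
    have hrR : ((i % n : ℕ) : ℝ) ≤ n := by exact_mod_cast hr.le
    have hpK : (p : ℝ) ≤ 2 * K := by
      have : p ≤ 2 * K := by omega
      exact_mod_cast this
    have hiR : (K : ℝ) * n ≤ i := by exact_mod_cast hi
    have hi0 : (0 : ℝ) ≤ i := Nat.cast_nonneg i
    have t1 : (i : ℝ) * (b n / n) ≤ p * b n + 2 * b n := by
      rw [← mul_div_assoc, div_le_iff₀ hnR]
      have : (i : ℝ) ≤ (p + 2) * n := by linarith
      nlinarith [mul_le_mul_of_nonneg_right this (hb0 n)]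
    have t2 : (p : ℝ) * i * e s ≤ i * (η / 3) := by
      have : (p : ℝ) * e s ≤ η / 3 := by nlinarith [mul_le_mul_of_nonneg_right hpK (he s)]
      nlinarith [mul_le_mul_of_nonneg_left this hi0]
    have t3 : 2 * b n ≤ i * (η / 3) := by
      have : (4 : ℝ) ≤ K * (η / 3) := by
        rw [div_le_iff₀ (by linarith)] at hKη
        linarith
      nlinarith [mul_le_mul_of_nonneg_right hiR (by positivity : (0:ℝ) ≤ η / 3)]
    linarith
  have hA0 : 0 < K * n := Nat.mul_pos hKn hn1
  have hN0 : 0 < N := lt_of_lt_of_le hA0 hN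
  have hq0 : N / (K * n) ≠ 0 := (Nat.div_pos hN hA0).ne'
  set t := Nat.log 2 (N / (K * n)) with ht
  have ht1 : 2 ^ t * (K * n) ≤ N :=
    (Nat.le_div_iff_mul_le hA0).1 (Nat.pow_log_le_self 2 hq0)
  have ht2 : N ≤ 2 ^ (t + 1) * (K * n) :=
    ((Nat.div_lt_iff_lt_mul hA0).1 (Nat.lt_pow_succ_log_self one_lt_two _)).le
  have hfin := block_lower_bound (fun t ht => hsup t (hs.trans ht))
    (hn.trans (Nat.le_mul_of_pos_left n hKn)) hγ t N ht1 ht2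
  have hpart : ∑ j ∈ Finset.range t, e (j + s) ≤ ∑' j, e (j + s) :=
    ((summable_nat_add_iff s).2 hsum).sum_le_tsum _ fun j _ => he _
  have hNR : (0 : ℝ) < N := by exact_mod_cast hN0
  rw [le_div_iff₀ hNR, mul_comm]
  refine le_trans (mul_le_mul_of_nonneg_left ?_ hNR.le) hfin
  linarith

/-! ### Poisson averages. -/

/-- The Poisson mass function. -/
noncomputable def poissonWeight (r : ℝ) (j : ℕ) : ℝ := Real.exp (-r) * (r ^ j / j.factorial)

/-- The expectation of `f` under the Poisson distribution. -/
noncomputable def poissonMean (r : ℝ) (f : ℕ → ℝ) : ℝ := ∑' j, poissonWeight r j * f j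

section

variable {r r₁ r₂ B C : ℝ} {f g : ℕ → ℝ}

lemma poissonWeight_nonneg (hr : 0 ≤ r) (j : ℕ) : 0 ≤ poissonWeight r j :=
  mul_nonneg (Real.exp_nonneg _) (by positivity)

lemma hasSum_poissonWeight (r : ℝ) : HasSum (poissonWeight r) 1 := by
  have h := (NormedSpace.expSeries_div_hasSum_exp r).mul_left (Real.exp (-r))
  rwa [← Real.exp_eq_exp_ℝ, ← Real.exp_add, neg_add_cancel, Real.exp_zero] at h

lemma summable_poissonWeight_mul (hr : 0 ≤ r) (hf : ∀ j, |f j| ≤ B) :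
    Summable fun j => poissonWeight r j * f j := by
  refine Summable.of_norm_bounded ((hasSum_poissonWeight r).summable.mul_right B) fun j => ?_
  rw [Real.norm_eq_abs, abs_mul, abs_of_nonneg (poissonWeight_nonneg hr j)]
  exact mul_le_mul_of_nonneg_left (hf j) (poissonWeight_nonneg hr j)

lemma poissonMean_mono (hr : 0 ≤ r) (hf : ∀ j, |f j| ≤ B) (hg : ∀ j, |g j| ≤ C)
    (h : ∀ j, f j ≤ g j) : poissonMean r f ≤ poissonMean r g :=
  (summable_poissonWeight_mul hr hf).tsum_le_tsum
    (fun j => mul_le_mul_of_nonneg_left (h j) (poissonWeight_nonneg hr j))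
    (summable_poissonWeight_mul hr hg)

lemma poissonMean_const (r a : ℝ) : poissonMean r (fun _ => a) = a := by
  rw [poissonMean, tsum_mul_right, (hasSum_poissonWeight r).tsum_eq, one_mul]

lemma poissonMean_add (hr : 0 ≤ r) (hf : ∀ j, |f j| ≤ B) (hg : ∀ j, |g j| ≤ C) :
    poissonMean r (fun j => f j + g j) = poissonMean r f + poissonMean r g := by
  simp only [poissonMean, mul_add]
  exact (summable_poissonWeight_mul hr hf).tsum_add (summable_poissonWeight_mul hr hg)

lemma poissonMean_mul_left (r a : ℝ) (f : ℕ → ℝ) :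
    poissonMean r (fun j => a * f j) = a * poissonMean r f := by
  rw [poissonMean, poissonMean, ← tsum_mul_left]
  exact tsum_congr fun j => by ring

lemma poissonMean_nonneg (hr : 0 ≤ r) (hf : ∀ j, 0 ≤ f j) : 0 ≤ poissonMean r f :=
  tsum_nonneg fun j => mul_nonneg (poissonWeight_nonneg hr j) (hf j)

lemma poissonMean_le (hr : 0 ≤ r) (hf : ∀ j, |f j| ≤ B) {a : ℝ} (h : ∀ j, f j ≤ a) :
    poissonMean r f ≤ a := by
  rw [← poissonMean_const r a]
  exact poissonMean_mono hr hf (fun _ => le_rfl) h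

lemma abs_ite_one_zero_le (p : ℕ → Prop) [DecidablePred p] (j : ℕ) :
    |if p j then (1 : ℝ) else 0| ≤ 1 := by
  split_ifs <;> simp

lemma poissonMean_add_compl (hr : 0 ≤ r) (p : ℕ → Prop) [DecidablePred p] :
    poissonMean r (fun j => if p j then 1 else 0)
      + poissonMean r (fun j => if ¬ p j then 1 else 0) = 1 := by
  rw [← poissonMean_add hr (abs_ite_one_zero_le p) (abs_ite_one_zero_le fun j => ¬ p j)]
  refine Eq.trans ?_ (poissonMean_const r 1)
  refine congrArg _ (funext fun j => ?_)
  by_cases h : p j <;> simp [h]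

lemma poissonWeight_succ (r : ℝ) (j : ℕ) :
    poissonWeight r (j + 1) * (j + 1 : ℕ) = r * poissonWeight r j := by
  have : ((j : ℝ) + 1) ≠ 0 := by positivity
  have : (j.factorial : ℝ) ≠ 0 := by positivity
  simp only [poissonWeight, Nat.factorial_succ]
  push_cast
  field_simp
  ring

lemma hasSum_poisson_mean (r : ℝ) : HasSum (fun j : ℕ => poissonWeight r j * j) r := by
  rw [← hasSum_nat_add_iff' 1]
  have h := (hasSum_poissonWeight r).mul_left r
  simpa [← poissonWeight_succ] using h

lemma hasSum_poisson_sq (r : ℝ) :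
    HasSum (fun j : ℕ => poissonWeight r j * (j : ℝ) ^ 2) (r ^ 2 + r) := by
  rw [← hasSum_nat_add_iff' 1]
  have h := ((hasSum_poisson_mean r).mul_left r).add ((hasSum_poissonWeight r).mul_left r)
  have e : ∀ j : ℕ, r * (poissonWeight r j * j) + r * poissonWeight r j
      = poissonWeight r (j + 1) * ((j + 1 : ℕ) : ℝ) ^ 2 := by
    intro j
    have := poissonWeight_succ r j
    push_cast at *
    linear_combination (-(j : ℝ) - 1) * this
  have e' : r ^ 2 + r - ∑ i ∈ Finset.range 1, poissonWeight r i * (i : ℝ) ^ 2 = r * r + r * 1 := by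
    simp
    ring
  rw [e']
  exact (congrArg (HasSum · _) (funext fun j => (e j).symm)).mpr h

lemma hasSum_poisson_variance (r : ℝ) :
    HasSum (fun j : ℕ => poissonWeight r j * ((j : ℝ) - r) ^ 2) r := by
  have h := ((hasSum_poisson_sq r).sub ((hasSum_poisson_mean r).mul_left (2 * r))).add
    ((hasSum_poissonWeight r).mul_left (r ^ 2))
  have e : r ^ 2 + r - 2 * r * r + r ^ 2 * 1 = r := by ring
  rw [e] at h
  refine (congrArg (HasSum · _) (funext fun j => ?_)).mpr h
  ring

/-- Chebyshev's inequality for the Poisson distribution. -/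
lemma poissonMean_deviation_le (hr : 0 ≤ r) {a : ℝ} (ha : 0 < a) (p : ℕ → Prop) [DecidablePred p]
    (hp : ∀ j : ℕ, p j → a ≤ |(j : ℝ) - r|) :
    poissonMean r (fun j => if p j then 1 else 0) ≤ r / a ^ 2 := by
  refine hasSum_le (fun j => ?_)
    (summable_poissonWeight_mul hr (abs_ite_one_zero_le p)).hasSum
    ((hasSum_poisson_variance r).div_const (a ^ 2))
  rw [mul_div_assoc]
  refine mul_le_mul_of_nonneg_left ?_ (poissonWeight_nonneg hr j)
  split_ifs with h
  · rw [one_le_div (by positivity), ← sq_abs ((j : ℝ) - r)]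
    exact pow_le_pow_left₀ ha.le (hp j h) 2
  · positivity

/-- Thinning of the Poisson distribution. -/
lemma poissonMean_split (h₁ : 0 ≤ r₁) (h₂ : 0 ≤ r₂) {p q : ℝ} (hp : (r₁ + r₂) * p = r₁)
    (hq : (r₁ + r₂) * q = r₂) {F : ℕ → ℕ → ℝ} (hF : ∀ i j, |F i j| ≤ B) :
    poissonMean (r₁ + r₂)
        (fun m => ∑ ij ∈ Finset.HasAntidiagonal.antidiagonal m, (m.choose ij.1 : ℝ) * p ^ ij.1 * q ^ ij.2
          * F ij.1 ij.2)
      = poissonMean r₁ fun i => poissonMean r₂ fun j => F i j := by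
  have key : ∀ m : ℕ, ∀ ij ∈ Finset.HasAntidiagonal.antidiagonal m,
      poissonWeight (r₁ + r₂) m * ((m.choose ij.1 : ℝ) * p ^ ij.1 * q ^ ij.2 * F ij.1 ij.2)
        = poissonWeight r₁ ij.1 * (poissonWeight r₂ ij.2 * F ij.1 ij.2) := by
    rintro m ⟨i, j⟩ hij
    rw [Finset.HasAntidiagonal.mem_antidiagonal] at hij
    simp only at hij
    subst hij
    have hc : ((i + j).choose i : ℝ) = (i + j).factorial / (i.factorial * j.factorial) := by
      rw [Nat.cast_choose ℝ (Nat.le_add_right i j), Nat.add_sub_cancel_left]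
    -- The product form of the relations on p and q, with no division, also covers r₁ + r₂ = 0, that
    -- is, clause density zero.
    have e1 : r₁ ^ i = (r₁ + r₂) ^ i * p ^ i := by rw [← mul_pow, hp]
    have e2 : r₂ ^ j = (r₁ + r₂) ^ j * q ^ j := by rw [← mul_pow, hq]
    have e3 : Real.exp (-(r₁ + r₂)) = Real.exp (-r₁) * Real.exp (-r₂) := by
      rw [← Real.exp_add]
      ring_nf
    have := Nat.factorial_ne_zero i
    have := Nat.factorial_ne_zero j
    have := Nat.factorial_ne_zero (i + j)
    simp only [poissonWeight]
    rw [hc, e1, e2, e3, pow_add]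
    field_simp
  have hs : Summable fun x : ℕ × ℕ => poissonWeight r₁ x.1 * (poissonWeight r₂ x.2 * F x.1 x.2) := by
    have h := ((hasSum_poissonWeight r₁).summable.mul_of_nonneg (hasSum_poissonWeight r₂).summable
      (poissonWeight_nonneg h₁) (poissonWeight_nonneg h₂)).mul_right B
    refine Summable.of_norm_bounded h fun x => ?_
    have a1 := poissonWeight_nonneg h₁ x.1
    have a2 := poissonWeight_nonneg h₂ x.2
    rw [← mul_assoc, Real.norm_eq_abs, abs_mul, abs_of_nonneg (mul_nonneg a1 a2)]
    exact mul_le_mul_of_nonneg_left (hF _ _) (mul_nonneg a1 a2)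
  simp only [poissonMean, Finset.mul_sum]
  rw [tsum_congr fun m => Finset.sum_congr rfl (key m)]
  have hs' := (Finset.HasAntidiagonal.sigmaAntidiagonalEquivProd (A := ℕ)).summable_iff.2 hs
  have h1 := hs'.tsum_sigma
  have h2 := Finset.HasAntidiagonal.sigmaAntidiagonalEquivProd.tsum_eq
    fun x : ℕ × ℕ => poissonWeight r₁ x.1 * (poissonWeight r₂ x.2 * F x.1 x.2)
  have h3 := hs.tsum_prod
  simp only [tsum_mul_left] at h3
  rw [← h3, ← h2]
  refine Eq.trans (tsum_congr fun m => ?_) h1.symm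
  rw [tsum_fintype, ← Finset.sum_coe_sort]
  rfl

/-- On [0, R] the series is dominated by B R^j/j!. Continuity serves to move the density slightly at
one fixed n. -/
lemma continuousOn_poissonMean (hf : ∀ j, |f j| ≤ B) (R : ℝ) :
    ContinuousOn (fun r => poissonMean r f) (Set.Icc 0 R) := by
  unfold poissonMean
  refine continuousOn_tsum (u := fun j : ℕ => R ^ j / (j.factorial : ℝ) * B) (fun j => ?_)
    ((Real.summable_pow_div_factorial R).mul_right B) fun j r hr => ?_
  · have h : Continuous fun r : ℝ => Real.exp (-r) * (r ^ j / (j.factorial : ℝ)) * f j :=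
      ((Real.continuous_exp.comp continuous_neg).mul
        ((continuous_pow j).div_const _)).mul continuous_const
    exact h.continuousOn
  · have h0 := poissonWeight_nonneg hr.1 j
    rw [Real.norm_eq_abs, abs_mul, abs_of_nonneg h0]
    refine mul_le_mul ?_ (hf j) (abs_nonneg _) ?_
    · have h1 : Real.exp (-r) ≤ 1 := Real.exp_le_one_iff.2 (by linarith [hr.1])
      have h2 : r ^ j / j.factorial ≤ R ^ j / j.factorial := by
        gcongr
        exacts [hr.1, hr.2]
      have h3 : 0 ≤ r ^ j / j.factorial := by have := hr.1; positivity
      calc poissonWeight r j ≤ 1 * (r ^ j / j.factorial) :=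
            mul_le_mul_of_nonneg_right h1 h3
        _ ≤ _ := by rwa [one_mul]
    · have := hr.1.trans hr.2
      positivity

/-- The Poisson distribution is at most its mean with probability bounded below. -/
lemma poissonMean_le_mean (hr : 4 < r) {m : ℕ} (hm : ∀ j : ℕ, (j : ℝ) ≤ r → j ≤ m) :
    Real.exp (-4) / 2 ≤ poissonMean r (fun j => if j ≤ m then 1 else 0) := by
  have hr0 : 0 < r := by linarith
  set t := Real.sqrt r with ht
  have htt : t ^ 2 = r := Real.sq_sqrt hr0.le
  have ht2 : 2 < t := by
    rw [ht, Real.lt_sqrt (by norm_num)]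
    linarith
  -- A change of measure: under mean r', two standard deviations of the original law lower,
  -- Chebyshev gives probability at least 3/4 to counts up to m.
  set r' := r - 2 * t with hr'
  have hr'0 : 0 < r' := by nlinarith
  have hr'' : 0 ≤ r' ^ 2 / r := by positivity
  have hI := abs_ite_one_zero_le (fun j => j ≤ m)
  -- The r'-weight is e² times the geometric mean of the weights for r and r'²/r, since r'²/r = r -
  -- 4t + 4; AM–GM then bounds it. Summing, 3/4 ≤ (e⁴/2)·ℙ + 1/2.
  have hpt : ∀ j, poissonWeight r' j
      ≤ Real.exp 4 / 2 * poissonWeight r j + 1 / 2 * poissonWeight (r' ^ 2 / r) j := by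
    intro j
    have hexp : Real.exp (-r') ^ 2
        = Real.exp 4 * Real.exp (-r) * Real.exp (-(r' ^ 2 / r)) := by
      rw [← Real.exp_nat_mul, ← Real.exp_add, ← Real.exp_add]
      congr 1
      have : r' ^ 2 / r = r - 4 * t + 4 := by
        rw [div_eq_iff hr0.ne', hr', ← htt]
        ring
      rw [this, hr']
      push_cast
      ring
    have hsq : poissonWeight r' j ^ 2
        = Real.exp 4 * poissonWeight r j * poissonWeight (r' ^ 2 / r) j := by
      simp only [poissonWeight, mul_pow, hexp]
      rw [show (r' ^ j / (j.factorial : ℝ)) ^ 2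
          = r ^ j / j.factorial * ((r' ^ 2 / r) ^ j / j.factorial) from ?_]
      · ring
      · rw [div_pow (r' ^ 2), ← pow_mul, mul_comm 2 j, pow_mul]
        field_simp
    have a0 := poissonWeight_nonneg hr0.le j
    have a1 := poissonWeight_nonneg hr'' j
    have hX : 0 ≤ Real.exp 4 / 2 * poissonWeight r j + 1 / 2 * poissonWeight (r' ^ 2 / r) j := by
      positivity
    refine abs_le_of_sq_le_sq' ?_ hX |>.2
    rw [hsq]
    nlinarith [sq_nonneg (Real.exp 4 / 2 * poissonWeight r j - 1 / 2 * poissonWeight (r' ^ 2 / r) j)]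
  have hle : poissonMean r' (fun j => if j ≤ m then 1 else 0)
      ≤ Real.exp 4 / 2 * poissonMean r (fun j => if j ≤ m then 1 else 0)
        + 1 / 2 * poissonMean (r' ^ 2 / r) (fun j => if j ≤ m then 1 else 0) := by
    refine hasSum_le (fun j => ?_) (summable_poissonWeight_mul hr'0.le hI).hasSum
      (((summable_poissonWeight_mul hr0.le hI).hasSum.mul_left _).add
        ((summable_poissonWeight_mul hr'' hI).hasSum.mul_left _))
    split_ifs
    · simpa using hpt j
    · simp
  have hone := poissonMean_le hr'' hI (a := 1) fun j => (abs_le.1 (hI j)).2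
  have hcheb := poissonMean_deviation_le (r := r') hr'0.le (a := 2 * t) (by linarith)
    (fun j => ¬ j ≤ m) (fun j hj => by
      have h1 : r < j := by
        by_contra! hjr
        exact hj (hm j hjr)
      exact le_trans (by linarith) (le_abs_self _))
  have hquarter : r' / (2 * t) ^ 2 ≤ 1 / 4 := by
    rw [div_le_div_iff₀ (by positivity) (by norm_num)]
    nlinarith
  have hsum := poissonMean_add_compl hr'0.le fun j => j ≤ m
  have hE : Real.exp (-4) * Real.exp 4 = 1 := by
    rw [← Real.exp_add]
    simp
  have h1 : (1 : ℝ) / 4 ≤ Real.exp 4 / 2 * poissonMean r (fun j => if j ≤ m then 1 else 0) := by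
    linarith
  have := mul_le_mul_of_nonneg_left h1 (Real.exp_nonneg (-4))
  have e : Real.exp (-4) * (Real.exp 4 / 2 * poissonMean r (fun j => if j ≤ m then 1 else 0))
      = poissonMean r (fun j => if j ≤ m then 1 else 0) / 2 := by
    linear_combination (poissonMean r (fun j => if j ≤ m then 1 else 0) / 2) * hE
  linarith

end

/-! ### Splitting the variables into two blocks. -/

/-- The uniform mass function on `Fin n`. -/
noncomputable def unif (n : ℕ) : Fin n → ℝ := fun _ => (n : ℝ)⁻¹

/-- The indicator of the empty set. -/
noncomputable def emptyIndicator {n : ℕ} (S : Finset (Fin n → Spin)) : ℝ := if S = ∅ then 1 else 0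

/-- `𝔼 log₂ (Z + 1)` for a random formula with `m` clauses on `n` variables. -/
noncomputable def meanLog {k : ℕ} (μ : PMF (ClauseType k)) (n m : ℕ) : ℝ :=
  ((clauseOp μ (unif n)) ^ m) logCount Finset.univ

/-- `ℙ (Z = 0)` for a random formula with `m` clauses on `n` variables. -/
noncomputable def unsatProb {k : ℕ} (μ : PMF (ClauseType k)) (n m : ℕ) : ℝ :=
  ((clauseOp μ (unif n)) ^ m) emptyIndicator Finset.univ

/-- The law of the image under `π` of a uniform index. -/
noncomputable def blockLaw {n' n : ℕ} (π : Fin n' → Fin n) : Fin n → ℝ :=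
  fun w => ∑ v, if π v = w then unif n' v else 0

/-- The assignments whose restrictions to the two blocks lie in `S₁` and `S₂`. -/
def blockProd {n₁ n₂ : ℕ} (S₁ : Finset (Fin n₁ → Spin)) (S₂ : Finset (Fin n₂ → Spin)) :
    Finset (Fin (n₁ + n₂) → Spin) :=
  Finset.univ.filter fun x =>
    (fun i => x (Fin.castAdd n₂ i)) ∈ S₁ ∧ (fun i => x (Fin.natAdd n₁ i)) ∈ S₂

section

variable {k n n' n₁ n₂ : ℕ} {μ : PMF (ClauseType k)}

lemma unif_mem (hn : n ≠ 0) : unif n ∈ stdSimplex ℝ (Fin n) := by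
  refine ⟨fun _ => by unfold unif; positivity, ?_⟩
  have : (n : ℝ) ≠ 0 := Nat.cast_ne_zero.2 hn
  simp [unif, this]

lemma blockLaw_mem (π : Fin n' → Fin n) (hn : n' ≠ 0) : blockLaw π ∈ stdSimplex ℝ (Fin n) := by
  refine ⟨fun w => Finset.sum_nonneg fun v _ => ?_, ?_⟩
  · split_ifs
    exacts [(unif_mem hn).1 v, le_rfl]
  · simp only [blockLaw]
    rw [Finset.sum_comm]
    simpa using (unif_mem hn).2

lemma unif_eq_combo (h₁ : n₁ ≠ 0) (h₂ : n₂ ≠ 0) :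
    unif (n₁ + n₂) = ((n₁ : ℝ) / (n₁ + n₂)) • blockLaw (Fin.castAdd n₂ : Fin n₁ → _)
      + ((n₂ : ℝ) / (n₁ + n₂)) • blockLaw (Fin.natAdd n₁ : Fin n₂ → _) := by
  have h₁' : (n₁ : ℝ) ≠ 0 := Nat.cast_ne_zero.2 h₁
  have h₂' : (n₂ : ℝ) ≠ 0 := Nat.cast_ne_zero.2 h₂
  have hlt : ∀ (i : Fin n₁) (j : Fin n₂), Fin.castAdd n₂ i ≠ Fin.natAdd n₁ j := by
    intro i j h
    have := congrArg Fin.val h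
    simp at this
    omega
  ext w
  refine Fin.addCases (fun i => ?_) (fun j => ?_) w
  · simp [blockLaw, unif, fun j => (hlt i j).symm]
    field_simp
  · simp [blockLaw, unif, fun i => hlt i j]
    field_simp

lemma clauseOp_blockLaw (π : Fin n' → Fin n) (h : Finset (Fin n → Spin) → ℝ)
    (S : Finset (Fin n → Spin)) :
    clauseOp μ (blockLaw π) h S
      = ∑ c : Clause k n', clauseWeight μ (unif n') c * h (S ∩ satSet (π ∘ c.1, c.2)) := by
  simp only [clauseOp_apply, clauseWeight, Fintype.sum_prod_type_right, mul_assoc, blockLaw]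
  refine Finset.sum_congr rfl fun φ _ => ?_
  exact sum_prod_map π (unif n') fun i => (μ φ).toReal * h (S ∩ satSet (i, φ))

lemma blockProd_inter_left (S₁ : Finset (Fin n₁ → Spin)) (S₂ : Finset (Fin n₂ → Spin))
    (c : Clause k n₁) :
    blockProd S₁ S₂ ∩ satSet (Fin.castAdd n₂ ∘ c.1, c.2) = blockProd (S₁ ∩ satSet c) S₂ := by
  ext x
  simp [blockProd, satSet]
  tauto

lemma blockProd_inter_right (S₁ : Finset (Fin n₁ → Spin)) (S₂ : Finset (Fin n₂ → Spin))
    (c : Clause k n₂) :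
    blockProd S₁ S₂ ∩ satSet (Fin.natAdd n₁ ∘ c.1, c.2) = blockProd S₁ (S₂ ∩ satSet c) := by
  ext x
  simp [blockProd, satSet]
  tauto

lemma blockProd_univ :
    blockProd (Finset.univ : Finset (Fin n₁ → Spin)) (Finset.univ : Finset (Fin n₂ → Spin))
      = Finset.univ := by
  simp [blockProd]

lemma card_blockProd (S₁ : Finset (Fin n₁ → Spin)) (S₂ : Finset (Fin n₂ → Spin)) :
    (blockProd S₁ S₂).card = S₁.card * S₂.card := by
  rw [← Finset.card_product]
  refine Finset.card_nbij' (fun x => (fun i => x (Fin.castAdd n₂ i), fun i => x (Fin.natAdd n₁ i)))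
    (fun y => Fin.append y.1 y.2) ?_ ?_ ?_ ?_
  · intro x hx
    simpa [blockProd] using hx
  · intro y hy
    simpa [blockProd] using hy
  · intro x _
    exact Fin.append_castAdd_natAdd
  · intro y _
    simp

/-- A clause with all its indices in the first block restricts only the first factor of a product
set, so the second stays frozen. -/
lemma clauseOp_pow_left (h : Finset (Fin (n₁ + n₂) → Spin) → ℝ) (S₁ : Finset (Fin n₁ → Spin))
    (S₂ : Finset (Fin n₂ → Spin)) (m : ℕ) :
    ((clauseOp μ (blockLaw (Fin.castAdd n₂ : Fin n₁ → _))) ^ m) h (blockProd S₁ S₂)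
      = ((clauseOp μ (unif n₁)) ^ m) (fun S => h (blockProd S S₂)) S₁ := by
  induction m generalizing h with
  | zero => simp
  | succ m ih =>
    rw [pow_succ, pow_succ, Module.End.mul_apply, Module.End.mul_apply, ih]
    refine congrFun (congrArg _ (funext fun S => ?_)) _
    rw [clauseOp_blockLaw, clauseOp_apply]
    simp only [blockProd_inter_left]

lemma clauseOp_pow_right (h : Finset (Fin (n₁ + n₂) → Spin) → ℝ) (S₁ : Finset (Fin n₁ → Spin))
    (S₂ : Finset (Fin n₂ → Spin)) (m : ℕ) :
    ((clauseOp μ (blockLaw (Fin.natAdd n₁ : Fin n₂ → _))) ^ m) h (blockProd S₁ S₂)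
      = ((clauseOp μ (unif n₂)) ^ m) (fun S => h (blockProd S₁ S)) S₂ := by
  induction m generalizing h with
  | zero => simp
  | succ m ih =>
    rw [pow_succ, pow_succ, Module.End.mul_apply, Module.End.mul_apply, ih]
    refine congrFun (congrArg _ (funext fun S => ?_)) _
    rw [clauseOp_blockLaw, clauseOp_apply]
    simp only [blockProd_inter_right]

lemma logCount_nonneg (S : Finset (Fin n → Spin)) : 0 ≤ logCount S :=
  Real.logb_nonneg (by norm_num) (by simp)

lemma logCount_mono : Monotone (logCount : Finset (Fin n → Spin) → ℝ) := fun _ _ h =>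
  Real.logb_le_logb_of_le (by norm_num) (by positivity)
    (by have := Finset.card_le_card h; gcongr)

lemma logCount_le (S : Finset (Fin n → Spin)) : logCount S ≤ n + 1 := by
  have h : (S.card : ℝ) ≤ 2 ^ n := by
    have := Finset.card_le_univ S
    simp only [Fintype.card_pi, Finset.prod_const, Finset.card_univ, Fintype.card_units_int,
      Fintype.card_fin] at this
    exact_mod_cast this
  have h1 : (1 : ℝ) ≤ 2 ^ n := one_le_pow₀ (by norm_num)
  calc logCount S ≤ Real.logb 2 (2 ^ (n + 1)) :=
        Real.logb_le_logb_of_le (by norm_num) (by positivity) (by rw [pow_succ]; linarith)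
    _ = n + 1 := by
      rw [Real.logb_pow, Real.logb_self_eq_one (by norm_num)]
      push_cast
      ring

lemma emptyIndicator_nonneg (S : Finset (Fin n → Spin)) : 0 ≤ emptyIndicator S := by
  unfold emptyIndicator
  split_ifs <;> norm_num

lemma emptyIndicator_le_one (S : Finset (Fin n → Spin)) : emptyIndicator S ≤ 1 := by
  unfold emptyIndicator
  split_ifs <;> norm_num

/-- For a, b ≥ 1 one has (a+1)(b+1) ≤ 2(ab+1), which costs one bit. If a factor is empty so is the
product, and the logarithm of the other factor is lost; this is how ℙ(Z=0) enters the
superadditivity defect. -/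
lemma logCount_blockProd_ge (S₁ : Finset (Fin n₁ → Spin)) (S₂ : Finset (Fin n₂ → Spin)) :
    logCount S₁ + logCount S₂ - 1 - (n₂ + 1) * emptyIndicator S₁ - (n₁ + 1) * emptyIndicator S₂
      ≤ logCount (blockProd S₁ S₂) := by
  have h0 := logCount_nonneg (blockProd S₁ S₂)
  have h1 := logCount_le S₁
  have h2 := logCount_le S₂
  have hn1 : (0 : ℝ) ≤ (n₁ : ℝ) + 1 := by positivity
  have hn2 : (0 : ℝ) ≤ (n₂ : ℝ) + 1 := by positivity
  by_cases e1 : S₁ = ∅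
  · have : logCount S₁ = 0 := by simp [logCount, e1]
    have := mul_nonneg hn1 (emptyIndicator_nonneg S₂)
    have : emptyIndicator S₁ = 1 := by simp [emptyIndicator, e1]
    rw [this]
    linarith
  by_cases e2 : S₂ = ∅
  · have : logCount S₂ = 0 := by simp [logCount, e2]
    have := mul_nonneg hn2 (emptyIndicator_nonneg S₁)
    have : emptyIndicator S₂ = 1 := by simp [emptyIndicator, e2]
    rw [this]
    linarith
  · have c1 : (1 : ℝ) ≤ S₁.card := by
      exact_mod_cast Finset.card_pos.2 (Finset.nonempty_iff_ne_empty.2 e1)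
    have c2 : (1 : ℝ) ≤ S₂.card := by
      exact_mod_cast Finset.card_pos.2 (Finset.nonempty_iff_ne_empty.2 e2)
    have hle : logCount S₁ + logCount S₂ ≤ 1 + logCount (blockProd S₁ S₂) := by
      have e : (1 : ℝ) = Real.logb 2 2 := (Real.logb_self_eq_one (by norm_num)).symm
      rw [e, logCount, logCount, logCount, card_blockProd,
        ← Real.logb_mul (by positivity) (by positivity),
        ← Real.logb_mul (by positivity) (by positivity)]
      refine Real.logb_le_logb_of_le (by norm_num) (by positivity) ?_
      push_cast
      nlinarith
    have i1 : emptyIndicator S₁ = 0 := by simp [emptyIndicator, e1]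
    have i2 : emptyIndicator S₂ = 0 := by simp [emptyIndicator, e2]
    rw [i1, i2]
    linarith

lemma clauseOp_pow_affine (hn : n ≠ 0) (a b : ℝ) (m : ℕ) :
    ((clauseOp μ (unif n)) ^ m) (fun S => a + logCount S - b * emptyIndicator S) Finset.univ
      = a + meanLog μ n m - b * unsatProb μ n m := by
  have e : (fun S : Finset (Fin n → Spin) => a + logCount S - b * emptyIndicator S)
      = (fun _ => a) + logCount - b • emptyIndicator := rfl
  rw [e, map_sub, map_add, map_smul, clauseOp_pow_const (unif_mem hn).2]
  rfl

lemma clauseOp_pow_le (hn : n ≠ 0) {h : Finset (Fin n → Spin) → ℝ} {a : ℝ} (hh : ∀ S, h S ≤ a)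
    (m : ℕ) : ((clauseOp μ (unif n)) ^ m) h Finset.univ ≤ a := by
  have := clauseOp_pow_mono (μ := μ) (unif_mem hn).1 m (show h ≤ fun _ => a from hh) Finset.univ
  rwa [clauseOp_pow_const (unif_mem hn).2] at this

lemma le_clauseOp_pow (hn : n ≠ 0) {h : Finset (Fin n → Spin) → ℝ} {a : ℝ} (hh : ∀ S, a ≤ h S)
    (m : ℕ) : a ≤ ((clauseOp μ (unif n)) ^ m) h Finset.univ := by
  have := clauseOp_pow_mono (μ := μ) (unif_mem hn).1 m (show (fun _ => a) ≤ h from hh) Finset.univ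
  rwa [clauseOp_pow_const (unif_mem hn).2] at this

lemma meanLog_nonneg (n m : ℕ) : 0 ≤ meanLog μ n m := by
  have h := clauseOp_pow_mono (μ := μ) (ρ := unif n) (fun _ => by unfold unif; positivity) m
    (show 0 ≤ logCount from logCount_nonneg) Finset.univ
  rwa [map_zero] at h

lemma meanLog_le (hn : n ≠ 0) (m : ℕ) : meanLog μ n m ≤ n + 1 :=
  clauseOp_pow_le hn logCount_le m

lemma unsatProb_nonneg (hn : n ≠ 0) (m : ℕ) : 0 ≤ unsatProb μ n m :=
  le_clauseOp_pow hn emptyIndicator_nonneg m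

lemma unsatProb_le_one (hn : n ≠ 0) (m : ℕ) : unsatProb μ n m ≤ 1 :=
  clauseOp_pow_le hn emptyIndicator_le_one m

lemma meanLog_antitone (hn : n ≠ 0) : Antitone (meanLog μ n) := fun _ _ hm =>
  clauseOp_pow_antitone (unif_mem hn).1 (unif_mem hn).2 logCount_mono hm Finset.univ

lemma unsatProb_mono (hn : n ≠ 0) : Monotone (unsatProb μ n) := by
  intro m m' hm
  have hmono : Monotone fun S : Finset (Fin n → Spin) => -emptyIndicator S := by
    intro S S' hS
    refine neg_le_neg ?_
    unfold emptyIndicator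
    split_ifs with h1 h2
    · exact le_rfl
    · exact absurd (Finset.subset_empty.1 (h1 ▸ hS)) h2
    · exact zero_le_one
    · exact le_rfl
  have h := clauseOp_pow_antitone (μ := μ) (unif_mem hn).1 (unif_mem hn).2 hmono hm Finset.univ
  have e : (fun S : Finset (Fin n → Spin) => -emptyIndicator S) = -emptyIndicator := rfl
  simp only [e, map_neg, Pi.neg_apply] at h
  exact neg_le_neg_iff.1 h

/-- Splitting the variables into two blocks: superadditivity of the expected logarithm, for a
binomially distributed number of clauses in each block. -/
lemma meanLog_split (hμ : H2 μ) (h₁ : n₁ ≠ 0) (h₂ : n₂ ≠ 0) (m : ℕ) :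
    ∑ ij ∈ Finset.HasAntidiagonal.antidiagonal m, (m.choose ij.1 : ℝ)
        * ((n₁ : ℝ) / (n₁ + n₂)) ^ ij.1 * ((n₂ : ℝ) / (n₁ + n₂)) ^ ij.2
        * (meanLog μ n₁ ij.1 + meanLog μ n₂ ij.2 - 1 - (n₂ + 1) * unsatProb μ n₁ ij.1
          - (n₁ + 1) * unsatProb μ n₂ ij.2)
      ≤ meanLog μ (n₁ + n₂) m := by
  have hn₁ : (0 : ℝ) < n₁ := Nat.cast_pos.2 (Nat.pos_of_ne_zero h₁)
  have hn₂ : (0 : ℝ) < n₂ := Nat.cast_pos.2 (Nat.pos_of_ne_zero h₂)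
  set p : ℝ := (n₁ : ℝ) / (n₁ + n₂) with hp
  set q : ℝ := (n₂ : ℝ) / (n₁ + n₂) with hq
  have hp0 : 0 ≤ p := by positivity
  have hq0 : 0 ≤ q := by positivity
  have hpq : p + q = 1 := by rw [hp, hq]; field_simp
  set T₁ := clauseOp μ (blockLaw (Fin.castAdd n₂ : Fin n₁ → _)) with hT₁
  set T₂ := clauseOp μ (blockLaw (Fin.natAdd n₁ : Fin n₂ → _)) with hT₂
  have hint := clauseOp_pow_logCount_concave hμ
    (blockLaw_mem (Fin.castAdd n₂ : Fin n₁ → _) h₁) (blockLaw_mem (Fin.natAdd n₁ : Fin n₂ → _) h₂)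
    hp0 hq0 hpq m Finset.univ
  rw [← unif_eq_combo h₁ h₂] at hint
  refine le_trans ?_ hint
  have hcomm : Commute (p • T₁) (q • T₂) :=
    (clauseOp_commute.smul_left p).smul_right q
  -- The binomial theorem for commuting operators distributes the m clauses over the two blocks.
  rw [hcomm.add_pow', LinearMap.sum_apply, Finset.sum_apply]
  refine Finset.sum_le_sum fun ij _ => ?_
  rw [smul_pow, smul_pow, smul_mul_smul_comm, LinearMap.smul_apply, LinearMap.smul_apply,
    Pi.smul_apply, Pi.smul_apply, nsmul_eq_mul, smul_eq_mul, ← mul_assoc, ← mul_assoc]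
  refine mul_le_mul_of_nonneg_left ?_ (by positivity)
  rw [Module.End.mul_apply, ← blockProd_univ, clauseOp_pow_left]
  -- The second block is averaged first, with S₁ frozen.
  have hstep : (fun S₁ => (meanLog μ n₂ ij.2 - 1 - (n₁ + 1) * unsatProb μ n₂ ij.2) + logCount S₁
      - (n₂ + 1) * emptyIndicator S₁)
      ≤ fun S₁ : Finset (Fin n₁ → Spin) =>
        (T₂ ^ ij.2) logCount (blockProd S₁ (Finset.univ : Finset (Fin n₂ → Spin))) := by
    intro S₁
    simp only
    rw [clauseOp_pow_right]
    have hS := clauseOp_pow_mono (μ := μ) (unif_mem h₂).1 ij.2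
      (show (fun S₂ : Finset (Fin n₂ → Spin) =>
          (logCount S₁ - 1 - (n₂ + 1) * emptyIndicator S₁) + logCount S₂
            - (n₁ + 1) * emptyIndicator S₂) ≤ fun S₂ => logCount (blockProd S₁ S₂) from
        fun S₂ => by
          have := logCount_blockProd_ge S₁ S₂
          simp only
          linarith) Finset.univ
    rw [clauseOp_pow_affine h₂] at hS
    refine le_trans (le_of_eq ?_) hS
    ring
  have hfin := clauseOp_pow_mono (μ := μ) (unif_mem h₁).1 ij.1 hstep Finset.univ
  rw [clauseOp_pow_affine h₁] at hfin
  refine le_trans (le_of_eq ?_) hfin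
  ring

end

/-! ### From operator powers to the random formula and its conditional law. -/

/-- The satisfying assignments of a formula. -/
noncomputable def solSet {k n m : ℕ} (F : Formula k n m) : Finset (Fin n → Spin) :=
  {x | ∀ a, x ∈ satSet (F a)}

section

variable {k n m : ℕ} {μ : PMF (ClauseType k)}

lemma mem_solSet {F : Formula k n m} {x : Fin n → Spin} :
    x ∈ solSet F ↔ ∀ a, x ∈ satSet (F a) := by
  simp [solSet]

lemma Z_eq_card (F : Formula k n m) : Z F = (solSet F).card := by
  rw [Z, ← Nat.card_eq_finsetCard]
  refine Nat.card_congr (Equiv.subtypeEquivRight fun x => ?_)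
  simp [mem_solSet, satSet, Satisfies]

/-- Each power imposes one more independent clause, so operator powers are expectations over random
formulas. -/
lemma clauseOp_pow_eq_sum (ρ : Fin n → ℝ) (h : Finset (Fin n → Spin) → ℝ)
    (S : Finset (Fin n → Spin)) (m : ℕ) :
    ((clauseOp μ ρ) ^ m) h S
      = ∑ F : Formula k n m, (∏ a, clauseWeight μ ρ (F a)) * h (S ∩ solSet F) := by
  induction m generalizing S with
  | zero =>
    have : ∀ F : Formula k n 0, solSet F = Finset.univ := fun F => by ext x; simp [mem_solSet]
    simp [this]
  | succ m ih =>
    rw [pow_succ', Module.End.mul_apply, clauseOp_apply,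
      ← Equiv.sum_comp (Fin.consEquiv fun _ : Fin (m + 1) => Clause k n)]
    refine Eq.trans ?_ (Fintype.sum_prod_type _).symm
    refine Finset.sum_congr rfl fun c _ => ?_
    rw [ih, Finset.mul_sum]
    refine Finset.sum_congr rfl fun F _ => ?_
    have e : solSet ((Fin.consEquiv fun _ : Fin (m + 1) => Clause k n) (c, F))
        = satSet c ∩ solSet F := by
      ext x
      simp [mem_solSet, Fin.consEquiv, Fin.forall_fin_succ]
    rw [e, Fin.prod_univ_succ, Finset.inter_assoc]
    simp [Fin.consEquiv, mul_assoc]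

lemma isProbabilityMeasure_uniformOn_univ (hn : n ≠ 0) :
    IsProbabilityMeasure (uniformOn (Set.univ : Set (Fin n))) := by
  have : Nonempty (Fin n) := Fin.pos_iff_nonempty.1 (Nat.pos_of_ne_zero hn)
  exact isProbabilityMeasure_uniformOn Set.finite_univ Set.univ_nonempty

lemma isProbabilityMeasure_clauseLaw (hn : n ≠ 0) : IsProbabilityMeasure (clauseLaw μ n) := by
  have := isProbabilityMeasure_uniformOn_univ hn
  unfold clauseLaw
  infer_instance

lemma isProbabilityMeasure_formulaLaw (α : ℝ≥0) (hn : n ≠ 0) :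
    IsProbabilityMeasure (formulaLaw μ α n) := by
  have := isProbabilityMeasure_clauseLaw (μ := μ) hn
  unfold formulaLaw
  infer_instance

lemma clauseLaw_singleton (hn : n ≠ 0) (c : Clause k n) :
    (clauseLaw μ n).real {c} = clauseWeight μ (unif n) c := by
  have := isProbabilityMeasure_uniformOn_univ hn
  obtain ⟨i, φ⟩ := c
  rw [clauseLaw, measureReal_def, ← Set.singleton_prod_singleton, Measure.prod_prod,
    Measure.pi_singleton, PMF.toMeasure_apply_singleton _ _ (measurableSet_singleton _),
    ENNReal.toReal_mul, ENNReal.toReal_prod]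
  simp [clauseWeight, unif, uniformOn_univ]

lemma formulaLaw_singleton (α : ℝ≥0) (hn : n ≠ 0) (F : Formula k n (numClauses α n)) :
    (formulaLaw μ α n).real {F} = ∏ a, clauseWeight μ (unif n) (F a) := by
  have := isProbabilityMeasure_clauseLaw (μ := μ) hn
  rw [formulaLaw, measureReal_def, Measure.pi_singleton, ENNReal.toReal_prod]
  exact Finset.prod_congr rfl fun a _ => clauseLaw_singleton hn (F a)

lemma integral_formulaLaw (α : ℝ≥0) (hn : n ≠ 0) (h : Finset (Fin n → Spin) → ℝ) :
    ∫ F, h (solSet F) ∂(formulaLaw μ α n)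
      = ((clauseOp μ (unif n)) ^ numClauses α n) h Finset.univ := by
  have := isProbabilityMeasure_formulaLaw (μ := μ) α hn
  rw [integral_fintype .of_finite, clauseOp_pow_eq_sum]
  simp [formulaLaw_singleton α hn]

lemma probFewer_zero (α : ℝ≥0) (hn : n ≠ 0) :
    probFewer μ n α 0 = unsatProb μ n (numClauses α n) := by
  rw [unsatProb, ← integral_formulaLaw α hn, probFewer]
  have e : (fun F : Formula k n (numClauses α n) => emptyIndicator (solSet F))
      = Set.indicator {F | (Z F : ℝ) < (2 : ℝ) ^ ((n : ℝ) * 0)} 1 := by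
    ext F
    simp only [mul_zero, Real.rpow_zero, Set.indicator, Set.mem_ofPred_eq, Pi.one_apply,
      emptyIndicator, Nat.cast_lt_one, Z_eq_card, Finset.card_eq_zero]
  rw [e, integral_indicator_one (Set.toFinite _).measurableSet]

lemma formulaLaw_satEvent (α : ℝ≥0) (hn : n ≠ 0) :
    (formulaLaw μ α n).real (satEvent k n (numClauses α n))
      = 1 - unsatProb μ n (numClauses α n) := by
  have := isProbabilityMeasure_formulaLaw (μ := μ) α hn
  rw [← probFewer_zero α hn, probFewer,
    ← probReal_compl_eq_one_sub (Set.toFinite _).measurableSet]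
  congr 1
  ext F
  simp [satEvent, Nat.one_le_iff_ne_zero]

lemma psi_eq (α : ℝ≥0) (hn : n ≠ 0) :
    psi μ n α = 1 / n * ((1 - unsatProb μ n (numClauses α n))⁻¹
      * ∫ F, Real.logb 2 (Z F) ∂(formulaLaw μ α n)) := by
  rw [psi, ProbabilityTheory.cond, integral_smul_measure, smul_eq_mul,
    setIntegral_eq_integral_of_forall_compl_eq_zero, ENNReal.toReal_inv, ← formulaLaw_satEvent α hn,
    measureReal_def]
  -- Since `Real.logb 2 0 = 0`, unsatisfiable formulas contribute nothing, and the restriction to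
  -- the event can be dropped.
  intro F hF
  have : Z F = 0 := by simpa [satEvent] using hF
  simp [this]

/-- Both logarithms vanish at Z = 0, and Z + 1 ≤ 2Z otherwise; the difference disappears after
division by n. -/
lemma integral_logb_Z_bounds (α : ℝ≥0) (hn : n ≠ 0) :
    meanLog μ n (numClauses α n) - 1 ≤ ∫ F, Real.logb 2 (Z F) ∂(formulaLaw μ α n) ∧
      ∫ F, Real.logb 2 (Z F) ∂(formulaLaw μ α n) ≤ meanLog μ n (numClauses α n) := by
  have := isProbabilityMeasure_formulaLaw (μ := μ) α hn
  have hsub : meanLog μ n (numClauses α n) - 1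
      = ∫ F, (logCount (solSet F) - 1) ∂(formulaLaw μ α n) := by
    rw [integral_sub .of_finite .of_finite, meanLog, integral_formulaLaw α hn]
    simp
  have hcase : ∀ F : Formula k n (numClauses α n), logCount (solSet F) - 1 ≤ Real.logb 2 (Z F) ∧
      Real.logb 2 (Z F) ≤ logCount (solSet F) := by
    intro F
    rw [Z_eq_card]
    rcases Nat.eq_zero_or_pos (solSet F).card with h | h
    · simp [logCount, h]
    · have hR : (1 : ℝ) ≤ (solSet F).card := by exact_mod_cast h
      refine ⟨?_, Real.logb_le_logb_of_le (by norm_num) (by linarith) (by linarith)⟩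
      have : logCount (solSet F) ≤ Real.logb 2 (2 * (solSet F).card) :=
        Real.logb_le_logb_of_le (by norm_num) (by positivity) (by linarith)
      rw [Real.logb_mul (by norm_num) (by linarith), Real.logb_self_eq_one (by norm_num)] at this
      linarith
  constructor
  · rw [hsub]
    exact integral_mono .of_finite .of_finite fun F => (hcase F).1
  · rw [meanLog, ← integral_formulaLaw α hn]
    exact integral_mono .of_finite .of_finite fun F => (hcase F).2

end

/-! ### The Poisson model. -/

/-- `𝔼 log₂ (Z + 1)` for a random formula on `n` variables with a Poisson number of clauses of
mean `β n`. -/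
noncomputable def poissonLog {k : ℕ} (μ : PMF (ClauseType k)) (β : ℝ) (n : ℕ) : ℝ :=
  poissonMean (β * n) (meanLog μ n)

/-- `ℙ (Z = 0)` for a random formula on `n` variables with a Poisson number of clauses of
mean `β n`. -/
noncomputable def poissonUnsat {k : ℕ} (μ : PMF (ClauseType k)) (β : ℝ) (n : ℕ) : ℝ :=
  poissonMean (β * n) (unsatProb μ n)

section

variable {k n n₁ n₂ : ℕ} {μ : PMF (ClauseType k)} {β : ℝ}

lemma abs_meanLog_le (hn : n ≠ 0) (m : ℕ) : |meanLog μ n m| ≤ n + 1 := by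
  rw [abs_of_nonneg (meanLog_nonneg n m)]
  exact meanLog_le hn m

lemma abs_unsatProb_le (hn : n ≠ 0) (m : ℕ) : |unsatProb μ n m| ≤ 1 := by
  rw [abs_of_nonneg (unsatProb_nonneg hn m)]
  exact unsatProb_le_one hn m

lemma poissonMean_affine {r B C : ℝ} (hr : 0 ≤ r) {f g : ℕ → ℝ} (hf : ∀ j, |f j| ≤ B)
    (hg : ∀ j, |g j| ≤ C) (a b : ℝ) :
    poissonMean r (fun j => a + f j + b * g j) = a + poissonMean r f + b * poissonMean r g := by
  rw [poissonMean_add (B := |a| + B) (C := |b| * C) hr, poissonMean_mul_left,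
    poissonMean_add (B := |a|) hr (fun _ => le_rfl) hf, poissonMean_const]
  · exact fun j => (abs_add_le _ _).trans (add_le_add le_rfl (hf j))
  · intro j
    rw [abs_mul]
    exact mul_le_mul_of_nonneg_left (hg j) (abs_nonneg b)

lemma abs_binomial_sum_le {p q B : ℝ} (hp : 0 ≤ p) (hq : 0 ≤ q) (hpq : p + q = 1)
    {F : ℕ → ℕ → ℝ} (hF : ∀ i j, |F i j| ≤ B) (m : ℕ) :
    |∑ ij ∈ Finset.HasAntidiagonal.antidiagonal m,
      (m.choose ij.1 : ℝ) * p ^ ij.1 * q ^ ij.2 * F ij.1 ij.2| ≤ B := by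
  have h1 : ∑ ij ∈ Finset.HasAntidiagonal.antidiagonal m,
      (m.choose ij.1 : ℝ) * p ^ ij.1 * q ^ ij.2 = 1 := by
    have := (Commute.all p q).add_pow' m
    rw [hpq, one_pow] at this
    rw [this]
    exact Finset.sum_congr rfl fun ij _ => by rw [nsmul_eq_mul, mul_assoc]
  refine (Finset.abs_sum_le_sum_abs _ _).trans ?_
  calc _ ≤ ∑ ij ∈ Finset.HasAntidiagonal.antidiagonal m,
        (m.choose ij.1 : ℝ) * p ^ ij.1 * q ^ ij.2 * B := by
        refine Finset.sum_le_sum fun ij _ => ?_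
        rw [abs_mul, abs_of_nonneg (by positivity)]
        exact mul_le_mul_of_nonneg_left (hF _ _) (by positivity)
    _ = B := by rw [← Finset.sum_mul, h1, one_mul]

/-- By thinning, the clause counts of the two blocks are independent Poisson variables with the same
density β, so the binomial inequality averages to a statement about one sequence in n. -/
lemma poissonLog_split (hμ : H2 μ) (hβ : 0 ≤ β) (h₁ : n₁ ≠ 0) (h₂ : n₂ ≠ 0) :
    poissonLog μ β n₁ + poissonLog μ β n₂ - 1 - (n₂ + 1) * poissonUnsat μ β n₁
      - (n₁ + 1) * poissonUnsat μ β n₂ ≤ poissonLog μ β (n₁ + n₂) := by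
  have hn₁ : (0 : ℝ) < n₁ := Nat.cast_pos.2 (Nat.pos_of_ne_zero h₁)
  have hn₂ : (0 : ℝ) < n₂ := Nat.cast_pos.2 (Nat.pos_of_ne_zero h₂)
  have hr₁ : 0 ≤ β * n₁ := by positivity
  have hr₂ : 0 ≤ β * n₂ := by positivity
  set F : ℕ → ℕ → ℝ := fun i j => meanLog μ n₁ i + meanLog μ n₂ j - 1
    - (n₂ + 1) * unsatProb μ n₁ i - (n₁ + 1) * unsatProb μ n₂ j with hF
  have hFB : ∀ i j, |F i j| ≤ n₁ + n₂ + 3 + (n₂ + 1) + (n₁ + 1) := by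
    intro i j
    have a1 := meanLog_nonneg (μ := μ) n₁ i
    have a2 := meanLog_nonneg (μ := μ) n₂ j
    have a3 := meanLog_le (μ := μ) h₁ i
    have a4 := meanLog_le (μ := μ) h₂ j
    have a5 := mul_nonneg (by positivity : (0 : ℝ) ≤ n₂ + 1) (unsatProb_nonneg (μ := μ) h₁ i)
    have a6 := mul_nonneg (by positivity : (0 : ℝ) ≤ n₁ + 1) (unsatProb_nonneg (μ := μ) h₂ j)
    have a7 := mul_le_mul_of_nonneg_left (unsatProb_le_one (μ := μ) h₁ i)
      (by positivity : (0 : ℝ) ≤ n₂ + 1)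
    have a8 := mul_le_mul_of_nonneg_left (unsatProb_le_one (μ := μ) h₂ j)
      (by positivity : (0 : ℝ) ≤ n₁ + 1)
    rw [abs_le]
    constructor <;> simp only [hF] <;> linarith
  have hsplit := poissonMean_split hr₁ hr₂ (p := (n₁ : ℝ) / (n₁ + n₂))
    (q := (n₂ : ℝ) / (n₁ + n₂)) (by field_simp) (by field_simp) hFB
  have hmono := poissonMean_mono (r := β * n₁ + β * n₂) (by positivity)
    (abs_binomial_sum_le (by positivity) (by positivity) (by field_simp) hFB)
    (abs_meanLog_le (by omega)) (meanLog_split hμ h₁ h₂)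
  rw [hsplit] at hmono
  have inner : ∀ i, poissonMean (β * n₂) (fun j => F i j)
      = (poissonLog μ β n₂ - 1 - (n₁ + 1) * poissonUnsat μ β n₂) + meanLog μ n₁ i
        + -((n₂ : ℝ) + 1) * unsatProb μ n₁ i := by
    intro i
    have := poissonMean_affine hr₂ (abs_meanLog_le (μ := μ) h₂) (abs_unsatProb_le (μ := μ) h₂)
      (meanLog μ n₁ i - 1 - (n₂ + 1) * unsatProb μ n₁ i) (-((n₁ : ℝ) + 1))
    rw [poissonLog, poissonUnsat]
    trans (meanLog μ n₁ i - 1 - (n₂ + 1) * unsatProb μ n₁ i)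
        + poissonMean (β * n₂) (meanLog μ n₂)
        + -((n₁ : ℝ) + 1) * poissonMean (β * n₂) (unsatProb μ n₂)
    · rw [← this]
      exact congrArg _ (funext fun j => by simp only [hF]; ring)
    · ring
  simp only [inner] at hmono
  rw [poissonMean_affine hr₁ (abs_meanLog_le h₁) (abs_unsatProb_le h₁), ← mul_add] at hmono
  have e : poissonLog μ β (n₁ + n₂) = poissonMean (β * (n₁ + n₂)) (meanLog μ (n₁ + n₂)) := by
    rw [poissonLog]
    push_cast
    rfl
  rw [e]
  refine le_trans (le_of_eq ?_) hmono
  rw [poissonLog, poissonUnsat]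
  ring

lemma poissonLog_nonneg (hβ : 0 ≤ β) (n : ℕ) : 0 ≤ poissonLog μ β n :=
  poissonMean_nonneg (by positivity) (meanLog_nonneg n)

lemma poissonLog_le (hβ : 0 ≤ β) (hn : 1 ≤ n) : poissonLog μ β n ≤ 2 * n := by
  have hn0 : n ≠ 0 := by omega
  have h : poissonLog μ β n ≤ n + 1 :=
    poissonMean_le (by positivity) (abs_meanLog_le hn0) (meanLog_le hn0)
  have : (1 : ℝ) ≤ n := by exact_mod_cast hn
  linarith

/-- A Poisson number of clauses of smaller mean gives a smaller probability of being
unsatisfiable, up to a large deviation. -/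
lemma poissonUnsat_le {α' : ℝ≥0} {β₁ : ℝ} (h : β₁ < α') (hβ : 0 ≤ β) (hβ₁ : β ≤ β₁) (hn : n ≠ 0) :
    poissonUnsat μ β n ≤ unsatProb μ n (numClauses α' n) + β₁ / (α' - β₁) ^ 2 / n := by
  have hnR : (0 : ℝ) < n := Nat.cast_pos.2 (Nat.pos_of_ne_zero hn)
  have hr : 0 ≤ β * n := by positivity
  set m := numClauses α' n with hm
  have hd : 0 < ((α' : ℝ) - β₁) * n := mul_pos (by linarith) hnR
  have hdev := poissonMean_deviation_le hr hd (fun j => ¬ j ≤ m) (by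
    intro j hj
    have h1 : (α' : ℝ) * n < j := (Nat.floor_lt (by positivity)).1 (not_le.1 hj)
    refine le_trans ?_ (le_abs_self _)
    nlinarith)
  have hle : poissonUnsat μ β n
      ≤ poissonMean (β * n) (fun j => unsatProb μ n m + (if ¬ j ≤ m then 1 else 0)) := by
    refine poissonMean_mono (C := 1 + 1) hr (abs_unsatProb_le hn) (fun j => ?_) fun j => ?_
    · exact (abs_add_le _ _).trans
        (add_le_add (abs_unsatProb_le hn m) (abs_ite_one_zero_le (fun j => ¬ j ≤ m) j))
    · split_ifs with hj
      · have := unsatProb_mono (μ := μ) hn hj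
        linarith
      · have := unsatProb_le_one (μ := μ) hn j
        have := unsatProb_nonneg (μ := μ) hn m
        linarith
  rw [poissonMean_add hr (fun _ => le_rfl) (abs_ite_one_zero_le fun j => ¬ j ≤ m),
    poissonMean_const] at hle
  have hlast : β * n / (((α' : ℝ) - β₁) * n) ^ 2 ≤ β₁ / (α' - β₁) ^ 2 / n := by
    have : 0 < (α' : ℝ) - β₁ := by linarith
    calc β * n / (((α' : ℝ) - β₁) * n) ^ 2 = β / (α' - β₁) ^ 2 / n := by field_simp
      _ ≤ _ := by gcongr
  linarith

/-- This is where the exponent 1 + ε in α* matters: for n ≥ 2^s the bound is a multiple of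
s^{-(1+ε)}, summable over dyadic scales. The Poisson tail adds a multiple of 2^{-s}. -/
lemma exists_summable_unsat_bound {α' : ℝ≥0} {β₁ ε : ℝ} (hε : 0 < ε)
    (hO : (fun n : ℕ => probFewer μ n α' 0) =O[atTop] (fun n : ℕ => 1 / Real.log n ^ (1 + ε)))
    (h0 : 0 ≤ β₁) (h : β₁ < α') :
    ∃ u : ℕ → ℝ, (∀ s, 0 ≤ u s) ∧ Summable u ∧ ∃ s₀ : ℕ, ∀ s, s₀ ≤ s → ∀ n, 2 ^ s ≤ n →
      ∀ β, 0 ≤ β → β ≤ β₁ → poissonUnsat μ β n ≤ u s := by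
  obtain ⟨C, hC0, hC⟩ := hO.exists_pos
  obtain ⟨n₀, hn₀⟩ := eventually_atTop.1 hC.bound
  have hlog2 : 0 < Real.log 2 := Real.log_pos (by norm_num)
  set D := β₁ / ((α' : ℝ) - β₁) ^ 2 with hD
  have hD0 : 0 ≤ D := by positivity
  refine ⟨fun s => C / Real.log 2 ^ (1 + ε) * (1 / (s : ℝ) ^ (1 + ε)) + D * (1 / 2) ^ s,
    fun s => by positivity, ?_, n₀ + 1, ?_⟩
  · exact ((Real.summable_one_div_nat_rpow.2 (by linarith)).mul_left _).add
      (summable_geometric_two.mul_left D)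
  · intro s hs n hn β hβ hβ₁
    have hsn : s < n := lt_of_lt_of_le Nat.lt_two_pow_self hn
    have hn0 : n ≠ 0 := by omega
    have hs0 : (0 : ℝ) < s := by
      have : 0 < s := by omega
      exact_mod_cast this
    have hnR : (2 : ℝ) ^ s ≤ n := by exact_mod_cast hn
    refine (poissonUnsat_le h hβ hβ₁ hn0).trans (add_le_add ?_ ?_)
    · have hb := hn₀ n (by omega)
      have hlog : s * Real.log 2 ≤ Real.log n := by
        rw [← Real.log_pow]
        exact Real.log_le_log (by positivity) hnR
      rw [probFewer_zero α' hn0] at hb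
      refine (le_abs_self _).trans (hb.trans ?_)
      have hpos : 0 < (s : ℝ) * Real.log 2 := by positivity
      rw [Real.norm_of_nonneg (by have := hpos.trans_le hlog; positivity)]
      calc C * (1 / Real.log n ^ (1 + ε)) ≤ C * (1 / (s * Real.log 2) ^ (1 + ε)) := by
            gcongr
        _ = _ := by
          rw [Real.mul_rpow hs0.le hlog2.le]
          ring
    · rw [one_div, inv_pow, div_eq_mul_inv]
      gcongr

/-- The normalized expected logarithm at a large scale is at least the one at any smaller scale, up
to an error that is uniform in the density. -/
lemma poissonLog_quasi_mono (hμ : H2 μ) {α' : ℝ≥0} {β₁ ε : ℝ} (hε : 0 < ε)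
    (hO : (fun n : ℕ => probFewer μ n α' 0) =O[atTop] (fun n : ℕ => 1 / Real.log n ^ (1 + ε)))
    (h0 : 0 ≤ β₁) (h : β₁ < α') {η : ℝ} (hη : 0 < η) :
    ∃ n₀ K : ℕ, ∀ β, 0 ≤ β → β ≤ β₁ → ∀ n, n₀ ≤ n → ∀ N, K * n ≤ N →
      poissonLog μ β n / n - η ≤ poissonLog μ β N / N := by
  obtain ⟨u, hu0, hu, s₀, hs₀⟩ := exists_summable_unsat_bound hε hO h0 h
  -- The penalties sum to at most (n₁+n₂+2)u ≤ 2(n₁+n₂)u, and the lost bit is at most (n₁+n₂)2^{-s}.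
  obtain ⟨n₀, K, hK⟩ := exists_uniform_lower_bound (e := fun s => 2 * u s + (1 / 2) ^ s)
    (fun s => by have := hu0 s; positivity) ((hu.mul_left 2).add summable_geometric_two) s₀ hη
  refine ⟨n₀, K, fun β hβ hβ₁ => hK (poissonLog μ β) (poissonLog_nonneg hβ)
    (fun i => poissonLog_le hβ) ?_⟩
  intro s hs n₁ n₂ h₁ h₂
  have p1 : 1 ≤ 2 ^ s := Nat.one_le_two_pow
  have hsplit := poissonLog_split hμ hβ (show n₁ ≠ 0 by omega) (show n₂ ≠ 0 by omega)
  have u1 := hs₀ s hs n₁ h₁ β hβ hβ₁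
  have u2 := hs₀ s hs n₂ h₂ β hβ hβ₁
  have r1 : (2 : ℝ) ^ s ≤ n₁ := by exact_mod_cast h₁
  have r2 : (2 : ℝ) ^ s ≤ n₂ := by exact_mod_cast h₂
  have p1R : (1 : ℝ) ≤ 2 ^ s := by exact_mod_cast p1
  have v1 := mul_le_mul_of_nonneg_left u1 (by positivity : (0 : ℝ) ≤ (n₂ : ℝ) + 1)
  have v2 := mul_le_mul_of_nonneg_left u2 (by positivity : (0 : ℝ) ≤ (n₁ : ℝ) + 1)
  have w : (1 : ℝ) ≤ (n₁ + n₂) * (1 / 2) ^ s := by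
    rw [one_div, inv_pow, ← div_eq_mul_inv, le_div_iff₀ (by positivity)]
    linarith
  have := mul_le_mul_of_nonneg_right (show (2 : ℝ) ≤ n₁ + n₂ by linarith) (hu0 s)
  linarith

end

/-! ### Existence of the limit and removal of the Poisson randomness. -/

/-- For fixed n ≥ n₀, letting N grow gives c n - η ≤ liminf c; the limsup over n then exceeds the
liminf by at most η. -/
lemma tendsto_of_quasi_mono {c : ℕ → ℝ} {B : ℝ} (h0 : ∀ n, 0 ≤ c n) (hB : ∀ n, c n ≤ B)
    (h : ∀ η > 0, ∃ n₀ K : ℕ, ∀ n, n₀ ≤ n → ∀ N, K * n ≤ N → c n - η ≤ c N) :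
    ∃ L, Tendsto c atTop (𝓝 L) := by
  have hbdA : IsBoundedUnder (· ≤ ·) atTop c := isBoundedUnder_of ⟨B, hB⟩
  have hbdB : IsBoundedUnder (· ≥ ·) atTop c := isBoundedUnder_of ⟨0, h0⟩
  refine ⟨liminf c atTop, tendsto_of_le_liminf_of_limsup_le le_rfl ?_ hbdA hbdB⟩
  refine le_of_forall_pos_le_add fun η hη => ?_
  obtain ⟨n₀, K, hK⟩ := h η hη
  refine limsup_le_of_le hbdB.isCoboundedUnder_le ?_
  filter_upwards [eventually_ge_atTop n₀] with n hn
  have : c n - η ≤ liminf c atTop :=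
    le_liminf_of_le hbdA.isCoboundedUnder_ge ((eventually_ge_atTop (K * n)).mono (hK n hn))
  linarith

section

variable {k : ℕ} {μ : PMF (ClauseType k)}

lemma exists_poissonLog_limit (hμ : H2 μ) {α' : ℝ≥0} {α ε : ℝ} (hε : 0 < ε)
    (hO : (fun n : ℕ => probFewer μ n α' 0) =O[atTop] (fun n : ℕ => 1 / Real.log n ^ (1 + ε)))
    (h0 : 0 ≤ α) (h : α < α') :
    ∃ L, Tendsto (fun n : ℕ => poissonLog μ α n / n) atTop (𝓝 L) := by
  refine tendsto_of_quasi_mono (B := 2)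
    (fun n => div_nonneg (poissonLog_nonneg h0 n) (Nat.cast_nonneg n)) (fun n => ?_) fun η hη => ?_
  · rcases Nat.eq_zero_or_pos n with rfl | hn
    · simp
    · rw [div_le_iff₀ (Nat.cast_pos.2 hn)]
      exact poissonLog_le h0 hn
  · obtain ⟨n₀, K, hK⟩ := poissonLog_quasi_mono hμ hε hO h0 h hη
    exact ⟨n₀, K, hK α h0 le_rfl⟩

/-- The limit of the Poisson model bounds the deterministic model from below, slightly above the
density as well. -/
lemma eventually_meanLog_ge (hμ : H2 μ) {α' : ℝ≥0} {α ε L : ℝ} (hε : 0 < ε)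
    (hO : (fun n : ℕ => probFewer μ n α' 0) =O[atTop] (fun n : ℕ => 1 / Real.log n ^ (1 + ε)))
    (h0 : 0 ≤ α) (h : α < α')
    (hL : Tendsto (fun n : ℕ => poissonLog μ α n / n) atTop (𝓝 L)) {η : ℝ} (hη : 0 < η) :
    ∃ δ > 0, ∀ᶠ N : ℕ in atTop, ∀ m : ℕ, (m : ℝ) ≤ (α + δ) * N → (L - η) * N ≤ meanLog μ N m := by
  obtain ⟨β₁, hβ₁, hβ₁'⟩ := exists_between h
  obtain ⟨n₀, K, hK⟩ := poissonLog_quasi_mono hμ hε hO (h0.trans hβ₁.le) hβ₁'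
    (show 0 < η / 4 by positivity)
  -- A single n is fixed here. Continuity at this n passes the bound from α to α + δ, and uniform
  -- quasi-monotonicity carries it to all large N; continuity of the limit in the density is never
  -- needed.
  obtain ⟨n, hnL, hn0, hn1⟩ := ((hL.eventually_const_lt (show L - η / 4 < L by linarith)).and
    ((eventually_ge_atTop n₀).and (eventually_ge_atTop 1))).exists
  have hnR : (0 : ℝ) < n := by exact_mod_cast hn1
  obtain ⟨δ, hδ, hδ₁, hδη⟩ : ∃ δ > 0, α + δ ≤ β₁ ∧
      poissonLog μ α n / n - η / 4 ≤ poissonLog μ (α + δ) n / n := by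
    have hcont := continuousOn_poissonMean (abs_meanLog_le (μ := μ) (show n ≠ 0 by omega)) (β₁ * n)
    obtain ⟨d, hd, hdist⟩ := Metric.continuousOn_iff.1 hcont (α * n)
      ⟨by positivity, by gcongr⟩ (η / 4 * n) (by positivity)
    refine ⟨min (β₁ - α) (d / (2 * n)), lt_min (by linarith) (by positivity), ?_, ?_⟩
    · linarith [min_le_left (β₁ - α) (d / (2 * n))]
    · set δ := min (β₁ - α) (d / (2 * n))
      have hδ0 : 0 ≤ δ := le_min (by linarith) (by positivity)
      have hδ1 : δ ≤ β₁ - α := min_le_left _ _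
      have hδ2 : δ * n ≤ d / 2 := by
        have := mul_le_mul_of_nonneg_right (min_le_right (β₁ - α) (d / (2 * n))) hnR.le
        refine this.trans (le_of_eq ?_)
        field_simp
      have hx := hdist ((α + δ) * n) ⟨by positivity, by gcongr; linarith⟩ (by
        rw [Real.dist_eq, show (α + δ) * n - α * n = δ * n by ring, abs_of_nonneg (by positivity)]
        linarith)
      rw [Real.dist_eq] at hx
      have := (abs_lt.1 hx).1
      rw [div_sub' hnR.ne', div_le_div_iff_of_pos_right hnR, poissonLog, poissonLog]
      linarith
  -- Half of δ is kept so that m lies δN/2 below the Poisson mean (α+δ)N. Counts below m then have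
  -- probability O(1/N), and larger counts only lower the expected logarithm.
  refine ⟨δ / 2, by positivity, ?_⟩
  have hlim : Tendsto (fun N : ℕ => 2 * (α + δ) / (δ / 2) ^ 2 / (N : ℝ)) atTop (𝓝 0) :=
    tendsto_const_div_atTop_nhds_zero_nat _
  filter_upwards [hlim.eventually_lt_const (show 0 < η / 4 by positivity),
    eventually_ge_atTop (K * n), eventually_ge_atTop 1] with N hN1 hN2 hN3 m hm
  have hN0 : N ≠ 0 := by omega
  have hNR : (1 : ℝ) ≤ N := by exact_mod_cast hN3
  have hr : 0 ≤ (α + δ) * N := by positivity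
  have hc := hK (α + δ) (by positivity) hδ₁ n hn0 N hN2
  have hdev := poissonMean_deviation_le hr (show 0 < δ / 2 * N by positivity) (fun j => j < m) (by
    intro j hj
    have : (j : ℝ) < m := by exact_mod_cast hj
    rw [abs_sub_comm]
    refine le_trans ?_ (le_abs_self _)
    linarith)
  have hle : poissonLog μ (α + δ) N ≤ poissonMean ((α + δ) * N)
      (fun j => meanLog μ N m + (N + 1) * (if j < m then 1 else 0)) := by
    refine poissonMean_mono (C := (N + 1) + (N + 1) * 1) hr (abs_meanLog_le hN0) (fun j => ?_)
      fun j => ?_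
    · refine (abs_add_le _ _).trans (add_le_add (abs_meanLog_le hN0 m) ?_)
      rw [abs_mul, abs_of_nonneg (by positivity : (0 : ℝ) ≤ (N : ℝ) + 1)]
      exact mul_le_mul_of_nonneg_left (abs_ite_one_zero_le (fun j => j < m) j) (by positivity)
    · split_ifs with hj
      · have := meanLog_le (μ := μ) hN0 j
        have := meanLog_nonneg (μ := μ) N m
        linarith
      · have := meanLog_antitone (μ := μ) hN0 (not_lt.1 hj)
        linarith
  have hB : ∀ j : ℕ, |(N + 1 : ℝ) * (if j < m then 1 else 0)| ≤ (N + 1 : ℝ) := by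
    intro j
    rw [abs_mul, abs_of_nonneg (by positivity : (0 : ℝ) ≤ (N : ℝ) + 1)]
    exact mul_le_of_le_one_right (by positivity) (abs_ite_one_zero_le (fun j => j < m) j)
  rw [poissonMean_add hr (fun _ => le_rfl) hB, poissonMean_const, poissonMean_mul_left] at hle
  have herr : (N + 1 : ℝ) * poissonMean ((α + δ) * N) (fun j => if j < m then 1 else 0)
      ≤ η / 4 * N := by
    calc _ ≤ (2 * N : ℝ) * ((α + δ) * N / (δ / 2 * N) ^ 2) := by
          refine mul_le_mul (by linarith) hdev (poissonMean_nonneg hr fun j => ?_) (by positivity)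
          split_ifs <;> norm_num
      _ = 2 * (α + δ) / (δ / 2) ^ 2 / N * N := by field_simp
      _ ≤ η / 4 * N := by gcongr
  have hfin : L - 3 * η / 4 ≤ poissonLog μ (α + δ) N / N := by linarith
  rw [le_div_iff₀ (by linarith)] at hfin
  linarith

lemma eventually_poissonMean_numClauses_ge (α : ℝ≥0) :
    ∀ᶠ n : ℕ in atTop, Real.exp (-4) / 2
      ≤ poissonMean ((α : ℝ) * n) (fun j => if j ≤ numClauses α n then 1 else 0) := by
  rcases eq_or_ne α 0 with rfl | hα
  · refine Eventually.of_forall fun n => ?_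
    have hdev := poissonMean_deviation_le (r := 0) le_rfl one_pos
      (fun j => ¬ j ≤ numClauses 0 n) (by
        intro j hj
        have : 1 ≤ j := by omega
        have : (1 : ℝ) ≤ j := by exact_mod_cast this
        rw [sub_zero]
        exact this.trans (le_abs_self _))
    have hsum := poissonMean_add_compl (r := 0) le_rfl (fun j => j ≤ numClauses 0 n)
    have : Real.exp (-4) ≤ 1 := Real.exp_le_one_iff.2 (by norm_num)
    rw [zero_div] at hdev
    simp only [NNReal.coe_zero, zero_mul]
    linarith
  · have hα' : (0 : ℝ) < α := by positivity
    have hlim : Tendsto (fun n : ℕ => (α : ℝ) * n) atTop atTop :=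
      tendsto_natCast_atTop_atTop.const_mul_atTop hα'
    filter_upwards [hlim.eventually_gt_atTop 4] with n hn
    exact poissonMean_le_mean hn fun j hj => Nat.le_floor hj

/-- The deterministic model has the same limit as the Poisson model. -/
lemma tendsto_meanLog (hμ : H2 μ) {α α' : ℝ≥0} {ε L : ℝ} (hε : 0 < ε)
    (hO : (fun n : ℕ => probFewer μ n α' 0) =O[atTop] (fun n : ℕ => 1 / Real.log n ^ (1 + ε)))
    (h : α < α') (hL : Tendsto (fun n : ℕ => poissonLog μ α n / n) atTop (𝓝 L)) :
    Tendsto (fun n : ℕ => meanLog μ n (numClauses α n) / n) atTop (𝓝 L) := by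
  have hα0 : (0 : ℝ) ≤ α := α.2
  set c₀ := Real.exp (-4) / 2 with hc₀
  have hc₀pos : 0 < c₀ := by positivity
  rw [Metric.tendsto_atTop']
  intro η' hη'
  -- The excess over (L-η)n will be at most 3ηn/c₀, and this choice makes it at most 3η'n/4.
  set η := min (η' / 2) (c₀ * η' / 4) with hηdef
  have hη : 0 < η := by positivity
  have hη1 : η ≤ η' / 2 := min_le_left _ _
  have hη2 : η ≤ c₀ * η' / 4 := min_le_right _ _
  obtain ⟨δ, hδ, hlow⟩ := eventually_meanLog_ge hμ hε hO hα0 h hL hη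
  have hlim : Tendsto (fun N : ℕ => |L - η| * α / δ ^ 2 / (N : ℝ)) atTop (𝓝 0) :=
    tendsto_const_div_atTop_nhds_zero_nat _
  have hev := hlow.and ((hlim.eventually_lt_const hη).and
    ((hL.eventually_lt_const (show L < L + η by linarith)).and
    ((eventually_poissonMean_numClauses_ge α).and (eventually_gt_atTop 0))))
  obtain ⟨n₁, hn₁⟩ := eventually_atTop.1 hev
  refine ⟨n₁, fun n hn => ?_⟩
  obtain ⟨hlow, herr, hup, hprob, hn0⟩ := hn₁ n hn.le
  have hn0' : n ≠ 0 := by omega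
  have hnR : (0 : ℝ) < n := by exact_mod_cast hn0
  set m := numClauses α n with hm
  set m' := ⌊((α : ℝ) + δ) * n⌋₊ with hm'
  have hr : 0 ≤ (α : ℝ) * n := by positivity
  have hm'le : (m' : ℝ) ≤ (α + δ) * n := Nat.floor_le (by positivity)
  have hmm' : m ≤ m' := Nat.floor_le_floor (by gcongr; linarith)
  have hmle : (m : ℝ) ≤ (α + δ) * n := le_trans (by exact_mod_cast hmm') hm'le
  have hGlow := hlow m hmle
  set ℓ := (L - η) * n with hℓ
  have hdev := poissonMean_deviation_le hr (show 0 < δ * n by positivity) (fun j => ¬ j ≤ m') (by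
    intro j hj
    have h1 : ((α : ℝ) + δ) * n < j := (Nat.floor_lt (by positivity)).1 (not_le.1 hj)
    refine le_trans ?_ (le_abs_self _)
    linarith)
  have b1 : ∀ j : ℕ, |(meanLog μ n m - ℓ) * (if j ≤ m then 1 else 0)| ≤ |meanLog μ n m - ℓ| * 1 :=
    fun j => by
      rw [abs_mul]
      exact mul_le_mul_of_nonneg_left (abs_ite_one_zero_le (fun j => j ≤ m) j) (abs_nonneg _)
  have b2 := abs_ite_one_zero_le fun j => ¬ j ≤ m'
  -- Counts up to m contribute at least the value at m, those between m and m' at least ℓ, and the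
  -- rest, being rare, at least 0. The average is below ℓ + 2ηn and the rare counts cost at most ηn,
  -- so the excess at m times c₀ is at most 3ηn.
  have hle : poissonMean ((α : ℝ) * n) (fun j => ℓ + (meanLog μ n m - ℓ) * (if j ≤ m then 1 else 0)
      + -|ℓ| * (if ¬ j ≤ m' then 1 else 0)) ≤ poissonLog μ α n := by
    refine poissonMean_mono (B := |ℓ| + |meanLog μ n m - ℓ| * 1 + |ℓ| * 1) hr (fun j => ?_)
      (abs_meanLog_le hn0') fun j => ?_
    · refine (abs_add_le _ _).trans
        (add_le_add ((abs_add_le _ _).trans (add_le_add le_rfl (b1 j))) ?_)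
      rw [abs_mul, abs_neg, abs_abs]
      exact mul_le_mul_of_nonneg_left (b2 j) (abs_nonneg _)
    · by_cases h1 : j ≤ m
      · have := meanLog_antitone (μ := μ) hn0' h1
        simp only [h1, h1.trans hmm', not_true_eq_false, if_true, if_false]
        linarith
      · by_cases h2 : j ≤ m'
        · have hj : (j : ℝ) ≤ (α + δ) * n := le_trans (by exact_mod_cast h2) hm'le
          have := hlow j hj
          simp only [h1, h2, not_true_eq_false, if_false]
          linarith
        · have := meanLog_nonneg (μ := μ) n j
          have := le_abs_self ℓ
          simp only [h1, h2, not_false_eq_true, if_true, if_false]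
          linarith
  rw [poissonMean_affine hr b1 b2, poissonMean_mul_left] at hle
  have herr' : |ℓ| * poissonMean ((α : ℝ) * n) (fun j => if ¬ j ≤ m' then 1 else 0) ≤ η * n := by
    calc _ ≤ |ℓ| * (α * n / (δ * n) ^ 2) := mul_le_mul_of_nonneg_left hdev (abs_nonneg _)
      _ = |L - η| * α / δ ^ 2 / n * n := by
        rw [hℓ, abs_mul, abs_of_pos hnR]
        field_simp
      _ ≤ η * n := by gcongr
  have hgap : 0 ≤ meanLog μ n m - ℓ := by linarith
  have hmul := mul_le_mul_of_nonneg_left hprob hgap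
  rw [div_lt_iff₀ hnR] at hup
  have hc : (meanLog μ n m - ℓ) * c₀ ≤ 3 * η * n := by
    have e : (L + η) * n = ℓ + 2 * η * n := by rw [hℓ]; ring
    rw [← hc₀] at hmul
    linarith
  have hG : meanLog μ n m - ℓ ≤ 3 / 4 * η' * n := by
    refine le_of_mul_le_mul_right (hc.trans ?_) hc₀pos
    have := mul_le_mul_of_nonneg_right hη2 hnR.le
    linarith
  have hηn := mul_le_mul_of_nonneg_right hη1 hnR.le
  have hpos : 0 < η * n := by positivity
  rw [Real.dist_eq, abs_lt]
  constructor
  · rw [lt_sub_iff_add_lt, lt_div_iff₀ hnR]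
    have : (-η' + L) * n = ℓ + η * n - η' * n := by rw [hℓ]; ring
    have := mul_pos hη' hnR
    linarith
  · rw [sub_lt_iff_lt_add, div_lt_iff₀ hnR]
    have : (η' + L) * n = ℓ + η * n + η' * n := by rw [hℓ]; ring
    have := mul_pos hη' hnR
    linarith

lemma tendsto_unsatProb {α α' : ℝ≥0} {ε : ℝ} (hε : 0 < ε)
    (hO : (fun n : ℕ => probFewer μ n α' 0) =O[atTop] (fun n : ℕ => 1 / Real.log n ^ (1 + ε)))
    (h : α ≤ α') : Tendsto (fun n : ℕ => unsatProb μ n (numClauses α n)) atTop (𝓝 0) := by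
  have hlog : Tendsto (fun n : ℕ => 1 / Real.log n ^ (1 + ε)) atTop (𝓝 0) := by
    simp only [one_div]
    exact ((tendsto_rpow_atTop (by linarith)).comp
      (Real.tendsto_log_atTop.comp tendsto_natCast_atTop_atTop)).inv_tendsto_atTop
  refine squeeze_zero' ?_ ?_ (hO.trans_tendsto hlog)
  · filter_upwards [eventually_ne_atTop 0] with n hn
    exact unsatProb_nonneg hn _
  · filter_upwards [eventually_ne_atTop 0] with n hn
    rw [probFewer_zero α' hn]
    exact unsatProb_mono hn (Nat.floor_le_floor (by gcongr))

lemma tendsto_psi {α : ℝ≥0} {L : ℝ}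
    (hL : Tendsto (fun n : ℕ => meanLog μ n (numClauses α n) / n) atTop (𝓝 L))
    (hq : Tendsto (fun n : ℕ => unsatProb μ n (numClauses α n)) atTop (𝓝 0)) :
    Tendsto (fun n : ℕ => psi μ n α) atTop (𝓝 L) := by
  have hI : Tendsto (fun n : ℕ => (∫ F, Real.logb 2 (Z F) ∂(formulaLaw μ α n)) / n) atTop
      (𝓝 L) := by
    have hlow : Tendsto (fun n : ℕ => meanLog μ n (numClauses α n) / n - 1 / n) atTop (𝓝 L) := by
      simpa using hL.sub (tendsto_const_div_atTop_nhds_zero_nat (1 : ℝ))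
    refine tendsto_of_tendsto_of_tendsto_of_le_of_le' hlow hL ?_ ?_
    · filter_upwards [eventually_ne_atTop 0] with n hn
      rw [← sub_div]
      exact div_le_div_of_nonneg_right (integral_logb_Z_bounds α hn).1 (Nat.cast_nonneg n)
    · filter_upwards [eventually_ne_atTop 0] with n hn
      exact div_le_div_of_nonneg_right (integral_logb_Z_bounds α hn).2 (Nat.cast_nonneg n)
  have hinv : Tendsto (fun n : ℕ => (1 - unsatProb μ n (numClauses α n))⁻¹) atTop (𝓝 1) := by
    simpa using (hq.const_sub 1).inv₀ (by norm_num)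
  have hmul := hinv.mul hI
  rw [one_mul] at hmul
  refine hmul.congr' ?_
  filter_upwards [eventually_ne_atTop 0] with n hn
  rw [psi_eq α hn]
  ring

/-- The gap between α and α' absorbs the Poisson fluctuations and the shift of the density. -/
lemma exists_gt_of_lt_alphaStar {α : ℝ≥0} (h : (α : ℝ≥0∞) < alphaStar μ) :
    ∃ α' : ℝ≥0, α < α' ∧ ∃ ε : ℝ, 0 < ε ∧
      (fun n : ℕ => probFewer μ n α' 0) =O[atTop] (fun n : ℕ => 1 / Real.log n ^ (1 + ε)) := by
  obtain ⟨_, ⟨α', hα', rfl⟩, hlt⟩ := lt_sSup_iff.1 h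
  exact ⟨α', ENNReal.coe_lt_coe.1 hlt, hα'⟩

end

end RandomCSP

theorem mainTheorem5 (k : ℕ) (μ : PMF (RandomCSP.ClauseType k)) (hμ : RandomCSP.H2 μ) :
    ∃ φs : ℝ≥0 → ℝ, ∀ α : ℝ≥0, (α : ℝ≥0∞) < RandomCSP.alphaStar μ →
      (∀ᶠ n : ℕ in atTop, 0 < RandomCSP.formulaLaw μ α n
        (RandomCSP.satEvent k n (RandomCSP.numClauses α n))) ∧
      Tendsto (fun n : ℕ => RandomCSP.psi μ n α) atTop (𝓝 (φs α)) := by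
  have key : ∀ α : ℝ≥0, ∃ L : ℝ, (α : ℝ≥0∞) < RandomCSP.alphaStar μ →
      (∀ᶠ n : ℕ in atTop, 0 < RandomCSP.formulaLaw μ α n
        (RandomCSP.satEvent k n (RandomCSP.numClauses α n))) ∧
      Tendsto (fun n : ℕ => RandomCSP.psi μ n α) atTop (𝓝 L) := by
    intro α
    by_cases hα : (α : ℝ≥0∞) < RandomCSP.alphaStar μ
    · obtain ⟨α', hlt, ε, hε, hO⟩ := RandomCSP.exists_gt_of_lt_alphaStar hα
      obtain ⟨L, hL⟩ := RandomCSP.exists_poissonLog_limit hμ hε hO α.2 hlt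
      have hq := RandomCSP.tendsto_unsatProb hε hO hlt.le
      refine ⟨L, fun _ => ⟨?_, RandomCSP.tendsto_psi
        (RandomCSP.tendsto_meanLog hμ hε hO hlt hL) hq⟩⟩
      filter_upwards [hq.eventually_lt_const one_pos, eventually_ne_atTop 0] with n hn hn0
      have h := RandomCSP.formulaLaw_satEvent (μ := μ) α hn0
      refine (ENNReal.toReal_pos_iff.1 ?_).1
      rw [← measureReal_def, h]
      linarith
    -- A default value; nothing is claimed at or above the threshold.
    · exact ⟨0, fun h => absurd h hα⟩
  choose φs hφs using key
  exact ⟨φs, hφs⟩
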